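/- **Setting.** Let $G$ be a countable infinite discrete group. Let $\mathcal T=(C_n,F_{n-1},\kappa_n,\nu_{n-1})_{n\ge 1}$ consist of finite subsets $F_n, C_n$ of $G$, non-degenerate probability measures $\kappa_n$ on $C_n$ and non-degenerate finite measures $\nu_n$ on $F_n$ (non-degenerate: every point of the set has positive mass) such that: * $F_0=\{1\}$ and, for all $n\ge 0$, $1\in F_n\cap C_{n+1}$, $\#C_{n+1}>1$, $F_nC_{n+1}\subset F_{n+1}$, and $F_nc\cap F_nc'=\emptyset$ for distinct $c,c'\in C_{n+1}$; * $\prod_{n\ge1}\max_{c\in C_n}\kappa_n(c)=0$; $\nu_0$ is the Dirac measure at $1$; $\nu_{n+1}(fc)=\nu_n(f)\kappa_{n+1}(c)$ for $f\in F_n$, $c\in C_{n+1}$, $n\ge 0$; * $\lim_{m\to\infty}\nu_m\big((F_nC_{n+1}\cdots C_m)\cap g^{-1}F_m\big)=\nu_n(F_n)$ for all $g\in G$, $n\ge0$; * $\lim_{n\to\infty}\nu_n(F_n)<\infty$. Let $X_n=F_n\times C_{n+1}\times C_{n+2}\times\cdots$ with the product topology, and let $X$ be the topological inductive limit of $X_0\to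 X_1\to\cdots$ under the embeddings $(f_n,c_{n+1},c_{n+2},\dots)\mapsto(f_nc_{n+1},c_{n+2},\dots)$, with its Borel $\sigma$-algebra. Let $\mu$ be the measure on $X$ with $\mu|_{X_n}=\nu_n\otimes\kappa_{n+1}\otimes\kappa_{n+2}\otimes\cdots$ for all $n$; it is finite. Let $X^G$ be the set of $x\in X$ such that for each $g\in G$ there is $n$ with $x=(f_n,c_{n+1},\dots)\in X_n$ and $gf_n\in F_n$; it is $\mu$-conull. For such $x$, $g$, $n$ put $T_gx=(gf_n,c_{n+1},c_{n+2},\dots)$ (outside $X^G$, put $T_gx=x$). Then $(X,\mu,T)$ is the nonsingular $(C,F)$-action associated with $\mathcal T$. For $n<m$ let $C_{n+1,m}=C_{n+1}\cdots C_m$ and $\kappa_{n+1,m}=\kappa_{n+1}*\cdots*\kappa_m$. For a strictly increasing integer sequence $\boldsymbol l=(l_n)_{n\ge0}$ with $l_0=0$, the $\boldsymbol l$-telescoping of $\mathcal T$ is $\widetilde{\mathcal T}=(\widetilde C_n,\widetilde F_{n-1},\widetilde\kappa_n,\widetilde\nu_{n-1})_{n\ge1}$ with $\widetilde F_n=F_{l_n}$,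 $\widetilde\nu_n=\nu_{l_n}$, $\widetilde C_{n+1}=C_{l_n+1,l_{n+1}}$, $\widetilde\kappa_{n+1}=\kappa_{l_n+1,l_{n+1}}$. With $\widetilde X$ its space, $\iota_{\boldsymbol l}:X\to\widetilde X$ is the canonical isomorphism: for the smallest $n$ with $x=(f,c_{l_n+1},c_{l_n+2},\dots)\in X_{l_n}$, $\iota_{\boldsymbol l}(x)=(f,\,c_{l_n+1}\cdots c_{l_{n+1}},\,c_{l_{n+1}+1}\cdots c_{l_{n+2}},\dots)\in\widetilde X_n$. Let $\Gamma$ be a subgroup of finite index in $G$; $G$ acts on the discrete space $G/\Gamma$ by left translations. For $g\in G$, $\mathcal T$ is compatible with $g\Gamma$ if $\sum_{n\ge1}\kappa_n(\{c\in C_n: c\notin g\Gamma g^{-1}\})<\infty$. For $x=(f_n,c_{n+1},\dots)\in X_n$ let $\pi_{(\mathcal T,g\Gamma)}(x)=\lim_{m\to\infty}f_nc_{n+1}\cdots c_m\,g\Gamma\in G/\Gamma$ where this limit exists (an arbitrary fixed value elsewhere). These notions apply also to telescopings. A measurable map $\tau$ from $X$ to a measurable $G$-space is called a factor map if for each $g\in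 G$, $\tau(T_gx)=g\tau(x)$ for $\mu$-a.e. $x$. **Theorem.** (A) The following are equivalent. 1. There is a factor map $\tau:X\to G/\Gamma$. 2. There is a sequence $(g_n)$ in $G$ such that $\displaystyle\lim_{N\to\infty}\ \sup_{m>n\ge N}\kappa_{n+1,m}\big(\{c\in C_{n+1,m}: c\notin g_n^{-1}\Gamma g_m\}\big)=0.$ 3. There are $g_0\in G$ and a telescoping of $\mathcal T$ which is compatible with $g_0\Gamma$. (B) If $g_0\in G$ and the $\boldsymbol q$-telescoping $\widetilde{\mathcal T}$ of $\mathcal T$ is compatible with $g_0\Gamma$, then the limit defining $\pi_{(\widetilde{\mathcal T},g_0\Gamma)}(\iota_{\boldsymbol q}(x))$ exists for $\mu$-a.e. $x\in X$, and $\pi_{(\widetilde{\mathcal T},g_0\Gamma)}\circ\iota_{\boldsymbol q}$ is a factor map $X\to G/\Gamma$. (C) For every factor map $\tau:X\to G/\Gamma$ there are $g_0\in G$ and $\boldsymbol q$ such that the $\boldsymbol q$-telescoping $\widetilde{\mathcal T}$ of $\mathcal T$ is compatible with $g_0\Gamma$ and $\tau=\pi_{(\widetilde{\mathcal T},g_0\Gamma)}\circ\iota_{\boldsymbol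 q}$ $\mu$-almost everywhere. (D) $T$ has no factor isomorphic to $G/\Gamma$ (that is, there is no factor map from $X$ to a measurable $G$-space isomorphic to $G/\Gamma$) if and only if for no $g\in G$ there is a telescoping of $\mathcal T$ compatible with $g\Gamma g^{-1}$ (the trivial coset of this subgroup). -/

import Mathlib

open Set Filter Topology MeasureTheory
open scoped Pointwise ENNReal

universe u

/-- `listProd a n m = a n * a (n+1) * ⋯ * a (m-1)`, in this order (the empty product if `m ≤ n`).
It is used for elements of a group and for subsets of a group (with the setwise product). -/
def listProd {M : Type*} [Monoid M] (a : ℕ → M) (n m : ℕ) : M :=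
  ((List.Ico n m).map a).prod

lemma listProd_self {M : Type*} [Monoid M] (a : ℕ → M) (n : ℕ) : listProd a n n = 1 := by
  simp [listProd]

lemma listProd_succ {M : Type*} [Monoid M] (a : ℕ → M) {n m : ℕ} (h : n ≤ m) :
    listProd a n (m + 1) = listProd a n m * a m := by
  simp [listProd, List.Ico.succ_top h]

/-- The convolution `κ n * κ (n+1) * ⋯ * κ (m-1)` of measures on `G`
(the Dirac measure at `1` if `m ≤ n`). -/
noncomputable def convProd {G : Type*} [Monoid G] [MeasurableSpace G]
    (κ : ℕ → Measure G) (n m : ℕ) : Measure G :=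
  ((List.Ico n m).map κ).foldl (fun μ ν => μ.mconv ν) (Measure.dirac 1)

/-- A sequence of finite subsets `F 0, F 1, …` and `C₁, C₂, …` of `G` as in the `(C,F)`-construction.
The sequence `C₁, C₂, …` is indexed from `0`: the set `C n` below is the set usually
denoted `C_{n+1}`, so that `F n * C n ⊆ F (n+1)`. -/
structure CFSeq (G : Type u) [Group G] where
  F : ℕ → Set G
  C : ℕ → Set G
  finite_F : ∀ n, (F n).Finite
  finite_C : ∀ n, (C n).Finite
  F_zero : F 0 = {1}
  one_mem_F : ∀ n, 1 ∈ F n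
  one_mem_C : ∀ n, 1 ∈ C n
  /-- `C n` has more than one element. -/
  nontrivial_C : ∀ n, (C n).Nontrivial
  mul_subset : ∀ n, F n * C n ⊆ F (n + 1)
  disjoint : ∀ n, ∀ c ∈ C n, ∀ c' ∈ C n, c ≠ c' → Disjoint (F n * {c}) (F n * {c'})

namespace CFSeq

variable {G : Type u} [Group G]

/-! ### The space of a `(C,F)`-sequence -/

/-- The set `X_n = F_n × C_{n+1} × C_{n+2} × ⋯` as a set of pairs
`(f, (c 0, c 1, …))` with `f ∈ F_n` and `c i ∈ C_{n+1+i}`. -/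
def levelSet (S : CFSeq G) (n : ℕ) : Set (G × (ℕ → G)) :=
  {p | p.1 ∈ S.F n ∧ ∀ i, p.2 i ∈ S.C (n + i)}

/-- `X_n` as a type; when `G` is a discrete space it carries the product topology. -/
abbrev Level (S : CFSeq G) (n : ℕ) : Type u := S.levelSet n

/-- The embedding `X_n → X_{n+1}`, `(f, c_{n+1}, c_{n+2}, …) ↦ (f c_{n+1}, c_{n+2}, …)`. -/
def embed (S : CFSeq G) (n : ℕ) (p : S.Level n) : S.Level (n + 1) :=
  ⟨(p.1.1 * p.1.2 0, fun i => p.1.2 (i + 1)),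
    S.mul_subset n (Set.mul_mem_mul p.2.1 (p.2.2 0)),
    fun i => by
      have h := p.2.2 (i + 1)
      have e : n + 1 + i = n + (i + 1) := by omega
      simpa only [e] using h⟩

/-- The inductive limit `X` of the sequence `X_0 → X_1 → X_2 → ⋯`: the quotient of the disjoint union
of the `X_n` by the equivalence relation generated by `p ∼ embed p`. -/
def Space (S : CFSeq G) : Type u :=
  Quot (fun a b : (Σ n, S.Level n) => b = ⟨a.1 + 1, S.embed a.1 a.2⟩)

/-- The canonical map `X_n → X`. -/
def incl (S : CFSeq G) (n : ℕ) (p : S.Level n) : S.Space := Quot.mk _ ⟨n, p⟩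

/-- The topology of the inductive limit. -/
instance [TopologicalSpace G] (S : CFSeq G) : TopologicalSpace S.Space :=
  inferInstanceAs (TopologicalSpace (Quot _))

/-- `X` carries its Borel `σ`-algebra. -/
instance [TopologicalSpace G] (S : CFSeq G) : MeasurableSpace S.Space := borel _

instance [TopologicalSpace G] (S : CFSeq G) : BorelSpace S.Space := ⟨rfl⟩

lemma incl_embed (S : CFSeq G) (n : ℕ) (p : S.Level n) :
    S.incl (n + 1) (S.embed n p) = S.incl n p :=
  (Quot.sound (r := fun a b : (Σ n, S.Level n) => b = ⟨a.1 + 1, S.embed a.1 a.2⟩)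
    (a := ⟨n, p⟩) rfl).symm

lemma range_incl_mono (S : CFSeq G) : Monotone fun n => range (S.incl n) := by
  refine monotone_nat_of_le_succ fun n => ?_
  rintro _ ⟨p, rfl⟩
  exact ⟨S.embed n p, S.incl_embed n p⟩

/-! ### The topological `(C,F)`-action -/

/-- The set `X^g`: the points `x = (f_n, c_{n+1}, …)` with `g f_n ∈ F_n` for some `n`. -/
def domain (S : CFSeq G) (g : G) : Set S.Space :=
  {x | ∃ (n : ℕ) (p : S.Level n), x = S.incl n p ∧ g * p.1.1 ∈ S.F n}

/-- The set `X^G = ⋂ g, X^g`. -/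
def fullDomain (S : CFSeq G) : Set S.Space := ⋂ g, S.domain g

open Classical in
/-- The `(C,F)`-action on `X^G`: `T_g (f_n, c_{n+1}, …) = (g f_n, c_{n+1}, …)` for any `n` with
`x = (f_n, c_{n+1}, …) ∈ X_n` and `g f_n ∈ F_n`. The points outside `X^G` are left fixed. -/
noncomputable def act (S : CFSeq G) (g : G) (x : S.Space) : S.Space :=
  if h : x ∈ S.fullDomain then
    let h' := mem_iInter.1 h g
    S.incl h'.choose ⟨(g * h'.choose_spec.choose.1.1, h'.choose_spec.choose.1.2),
      h'.choose_spec.choose_spec.2, h'.choose_spec.choose.2.2⟩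
  else x

/-! ### Telescopings -/

/-- `C_{n+1} C_{n+2} ⋯ C_m`. -/
def Cprod (S : CFSeq G) (n m : ℕ) : Set G := listProd S.C n m

lemma Cprod_self (S : CFSeq G) (n : ℕ) : S.Cprod n n = {1} := by
  rw [Cprod, listProd_self, Set.singleton_one]

lemma Cprod_succ (S : CFSeq G) {n m : ℕ} (h : n ≤ m) :
    S.Cprod n (m + 1) = S.Cprod n m * S.C m := listProd_succ _ h

lemma finite_Cprod (S : CFSeq G) {n m : ℕ} (h : n ≤ m) : (S.Cprod n m).Finite := by
  induction m, h using Nat.le_induction with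
  | base => simp [Cprod_self]
  | succ m h ih => rw [S.Cprod_succ h]; exact ih.mul (S.finite_C m)

lemma one_mem_Cprod (S : CFSeq G) {n m : ℕ} (h : n ≤ m) : (1 : G) ∈ S.Cprod n m := by
  induction m, h using Nat.le_induction with
  | base => simp [Cprod_self]
  | succ m h ih =>
    rw [S.Cprod_succ h]
    exact ⟨1, ih, 1, S.one_mem_C m, by simp⟩

lemma nontrivial_Cprod (S : CFSeq G) {n m : ℕ} (h : n < m) : (S.Cprod n m).Nontrivial := by
  obtain ⟨m, rfl⟩ : ∃ k, m = k + 1 := ⟨m - 1, by omega⟩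
  have h' : n ≤ m := by omega
  rw [S.Cprod_succ h']
  exact (S.nontrivial_C m).mono fun c hc => ⟨1, S.one_mem_Cprod h', c, hc, by simp⟩

lemma mul_Cprod_subset (S : CFSeq G) {n m : ℕ} (h : n ≤ m) : S.F n * S.Cprod n m ⊆ S.F m := by
  induction m, h using Nat.le_induction with
  | base => simp [Cprod_self]
  | succ m h ih =>
    rw [S.Cprod_succ h, ← mul_assoc]
    exact (Set.mul_subset_mul_right ih).trans (S.mul_subset m)

lemma Cprod_inj (S : CFSeq G) {n m : ℕ} (h : n ≤ m) :
    ∀ f ∈ S.F n, ∀ f' ∈ S.F n, ∀ c ∈ S.Cprod n m, ∀ c' ∈ S.Cprod n m,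
      f * c = f' * c' → c = c' := by
  induction m, h using Nat.le_induction with
  | base =>
    intro f _ f' _ c hc c' hc' _
    rw [Cprod_self] at hc hc'
    exact hc.trans hc'.symm
  | succ m h ih =>
    intro f hf f' hf' c hc c' hc' e
    rw [S.Cprod_succ h] at hc hc'
    obtain ⟨a, ha, b, hb, rfl⟩ := hc
    obtain ⟨a', ha', b', hb', rfl⟩ := hc'
    simp only [← mul_assoc] at e
    have h1 := S.mul_Cprod_subset h (Set.mul_mem_mul hf ha)
    have h2 := S.mul_Cprod_subset h (Set.mul_mem_mul hf' ha')
    have hbb : b = b' := by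
      by_contra hne
      refine Set.disjoint_left.1 (S.disjoint m b hb b' hb' hne)
        (Set.mul_mem_mul h1 (mem_singleton b)) ?_
      rw [e]
      exact Set.mul_mem_mul h2 (mem_singleton b')
    subst hbb
    rw [ih f hf f' hf' a ha a' ha' (mul_right_cancel e)]

end CFSeq

/-- The sequences `0 = l 0 < l 1 < l 2 < ⋯` along which one telescopes. -/
structure IsTelescopingSeq (l : ℕ → ℕ) : Prop where
  zero : l 0 = 0
  strictMono : StrictMono l

namespace CFSeq

variable {G : Type u} [Group G]

/-- The `l`-telescoping: `F̃_n = F_{l_n}` and `C̃_{n+1} = C_{l_n+1} ⋯ C_{l_{n+1}}`. -/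
def telescope (S : CFSeq G) (l : ℕ → ℕ) (hl : IsTelescopingSeq l) : CFSeq G where
  F n := S.F (l n)
  C n := S.Cprod (l n) (l (n + 1))
  finite_F n := S.finite_F _
  finite_C n := S.finite_Cprod (hl.strictMono n.lt_succ_self).le
  F_zero := by rw [hl.zero, S.F_zero]
  one_mem_F n := S.one_mem_F _
  one_mem_C n := S.one_mem_Cprod (hl.strictMono n.lt_succ_self).le
  nontrivial_C n := S.nontrivial_Cprod (hl.strictMono n.lt_succ_self)
  mul_subset n := S.mul_Cprod_subset (hl.strictMono n.lt_succ_self).le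
  disjoint n c hc c' hc' hne := by
    rw [Set.disjoint_left]
    rintro x ⟨f, hf, _, rfl, rfl⟩ ⟨f', hf', _, rfl, e⟩
    exact hne (S.Cprod_inj (hl.strictMono n.lt_succ_self).le f hf f' hf' _ hc _ hc' e.symm)

lemma listProd_mem_Cprod (S : CFSeq G) (k : ℕ) (c : ℕ → G) (hc : ∀ i, c i ∈ S.C (k + i))
    {a b : ℕ} (h : a ≤ b) : listProd c a b ∈ S.Cprod (k + a) (k + b) := by
  induction b, h using Nat.le_induction with
  | base => simp [Cprod_self, listProd_self]
  | succ b h ih =>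
    rw [listProd_succ c h, ← add_assoc, S.Cprod_succ (by omega)]
    exact Set.mul_mem_mul ih (hc b)

/-- The map `X_{l_n} → X̃_n`,
`(f, c_{l_n+1}, c_{l_n+2}, …) ↦ (f, c_{l_n+1} ⋯ c_{l_{n+1}}, c_{l_{n+1}+1} ⋯ c_{l_{n+2}}, …)`. -/
def telescopeLevel (S : CFSeq G) (l : ℕ → ℕ) (hl : IsTelescopingSeq l) (n : ℕ)
    (p : S.Level (l n)) : (S.telescope l hl).Level n :=
  ⟨(p.1.1, fun i => listProd p.1.2 (l (n + i) - l n) (l (n + i + 1) - l n)), p.2.1, fun i => by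
    have h1 : l n ≤ l (n + i) := hl.strictMono.monotone (by omega)
    have h2 : l (n + i) ≤ l (n + i + 1) := hl.strictMono.monotone (by omega)
    have h := S.listProd_mem_Cprod (l n) p.1.2 p.2.2
      (show l (n + i) - l n ≤ l (n + i + 1) - l n by omega)
    rwa [show l n + (l (n + i) - l n) = l (n + i) by omega,
      show l n + (l (n + i + 1) - l n) = l (n + i + 1) by omega] at h⟩

lemma exists_rep (S : CFSeq G) (l : ℕ → ℕ) (hl : IsTelescopingSeq l) (x : S.Space) :
    ∃ n, ∃ p : S.Level (l n), S.incl (l n) p = x := by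
  induction x using Quot.ind with
  | mk a =>
    obtain ⟨m, p⟩ := a
    exact ⟨m, S.range_incl_mono (hl.strictMono.le_apply (x := m)) ⟨p, rfl⟩⟩

open Classical in
/-- The canonical identification `ι_l : X → X̃` of the space of `S` with that of its `l`-telescoping:
take the smallest `n` with `x ∈ X_{l_n}` and group the coordinates of `x` in `X_{l_n}`. -/
noncomputable def iota (S : CFSeq G) (l : ℕ → ℕ) (hl : IsTelescopingSeq l) (x : S.Space) :
    (S.telescope l hl).Space :=
  (S.telescope l hl).incl (Nat.find (S.exists_rep l hl x))
    (S.telescopeLevel l hl _ (Nat.find_spec (S.exists_rep l hl x)).choose)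

/-! ### The explicit map to a coset space -/

/-- `S.IsFactorValue q x j` says that, for `x = (f_n, c_{n+1}, c_{n+2}, …) ∈ X_n`, the limit of
`f_n c_{n+1} ⋯ c_m q` as `m → ∞` exists in the coset space `G ⧸ Γ` and is equal to `j`
(`G` is discrete, hence so is `G ⧸ Γ`). -/
def IsFactorValue [TopologicalSpace G] (S : CFSeq G) {Γ : Subgroup G} (q : G ⧸ Γ)
    (x : S.Space) (j : G ⧸ Γ) : Prop :=
  ∃ (n : ℕ) (p : S.Level n), x = S.incl n p ∧
    Tendsto (fun m => (p.1.1 * listProd p.1.2 0 m) • q) atTop (𝓝 j)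

open Classical in
/-- The map `x ↦ lim f_n c_{n+1} ⋯ c_m q`. Where the limit does not exist,
the value is the irrelevant coset `q`. -/
noncomputable def factorMap [TopologicalSpace G] (S : CFSeq G) {Γ : Subgroup G} (q : G ⧸ Γ)
    (x : S.Space) : G ⧸ Γ :=
  if h : ∃ j, S.IsFactorValue q x j then h.choose else q

end CFSeq

/-- A sequence `𝒯 = (C_n, F_{n-1}, κ_n, ν_{n-1})_{n ≥ 1}`. As for `C`, the measure `κ n` is the
one usually denoted `κ_{n+1}`. The conditions on the measures are in `CFData.Admissible`. -/
structure CFData (G : Type u) [Group G] [MeasurableSpace G] extends CFSeq G where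
  κ : ℕ → Measure G
  ν : ℕ → Measure G

namespace CFData

variable {G : Type u} [Group G] [MeasurableSpace G]

/-- The conditions on the measures of a sequence `𝒯` that defines a nonsingular `(C,F)`-action. -/
structure Admissible (D : CFData G) : Prop where
  /-- `κ n` is a non-degenerate probability measure on `C n`. -/
  prob_κ : ∀ n, IsProbabilityMeasure (D.κ n)
  supp_κ : ∀ n, D.κ n (D.C n)ᶜ = 0
  pos_κ : ∀ n, ∀ c ∈ D.C n, 0 < D.κ n {c}
  /-- `ν n` is a non-degenerate finite measure on `F n`. -/
  fin_ν : ∀ n, IsFiniteMeasure (D.ν n)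
  supp_ν : ∀ n, D.ν n (D.F n)ᶜ = 0
  pos_ν : ∀ n, ∀ f ∈ D.F n, 0 < D.ν n {f}
  ν_zero : D.ν 0 = Measure.dirac 1
  /-- `∏_n max_{c ∈ C_n} κ_n(c) = 0`, i.e. the measure `μ` below is non-atomic. -/
  nonatomic : Tendsto (fun N => ∏ n ∈ Finset.range N, ⨆ c ∈ D.C n, D.κ n {c}) atTop (𝓝 0)
  ν_mul : ∀ n, ∀ f ∈ D.F n, ∀ c ∈ D.C n, D.ν (n + 1) {f * c} = D.ν n {f} * D.κ n {c}
  /-- `lim_m ν_m((F_n C_{n+1} ⋯ C_m) ∩ g⁻¹ F_m) = ν_n(F_n)` for all `g` and `n`,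
  i.e. the complement of `X^G` has measure zero. -/
  full : ∀ (g : G) (n : ℕ),
    Tendsto (fun m => D.ν m ((D.F n * D.Cprod n m) ∩ g⁻¹ • D.F m)) atTop (𝓝 (D.ν n (D.F n)))

/-- `κ_{n+1} * κ_{n+2} * ⋯ * κ_m`, the measure usually denoted `κ_{n+1,m}`. -/
noncomputable def κprod (D : CFData G) (n m : ℕ) : Measure G := convProd D.κ n m

/-- The `l`-telescoping of `𝒯`. -/
noncomputable def telescope (D : CFData G) (l : ℕ → ℕ) (hl : IsTelescopingSeq l) : CFData G where
  toCFSeq := D.toCFSeq.telescope l hl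
  κ n := D.κprod (l n) (l (n + 1))
  ν n := D.ν (l n)

/-- `𝒯` is compatible with the coset `g Γ`: `∑_n κ_n {c ∈ C_n | c ∉ g Γ g⁻¹} < ∞`. -/
def CompatibleWith (D : CFData G) (Γ : Subgroup G) (g : G) : Prop :=
  ∑' n, D.κ n {c ∈ D.C n | c ∉ Γ.map (MulAut.conj g).toMonoidHom} < ∞

/-- The measure `ν_n ⊗ κ_{n+1} ⊗ κ_{n+2} ⊗ ⋯` on `X_n`. -/
noncomputable def levelMeasure (D : CFData G) (n : ℕ) : Measure (D.Level n) :=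
  ((D.ν n).prod (Measure.infinitePi fun i => D.κ (n + i))).comap Subtype.val

variable [TopologicalSpace G]

/-- The nonsingular `(C,F)`-measure `μ` on `X`: on `X_n ∖ X_{n-1}` it is the image of
`ν_n ⊗ κ_{n+1} ⊗ κ_{n+2} ⊗ ⋯`. -/
noncomputable def μ (D : CFData G) : Measure D.Space :=
  Measure.sum fun n => ((D.levelMeasure n).map (D.incl n)).restrict
    (disjointed (fun k => range (D.incl k)) n)

/-- A measurable map `φ` from `X` to a measurable `G`-space which is equivariant `μ`-a.e. -/
def IsFactorMap (D : CFData G) {Y : Type*} [MeasurableSpace Y] [MulAction G Y]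
    (φ : D.Space → Y) : Prop :=
  Measurable φ ∧ ∀ g : G, ∀ᵐ x ∂D.μ, φ (D.act g x) = g • φ x

/-- The `(C,F)`-action associated with `𝒯` has a factor isomorphic to `G ⧸ Γ`. -/
def HasFactorIsomorphicTo (D : CFData G) (Γ : Subgroup G) : Prop :=
  ∃ (Y : Type u) (_ : MeasurableSpace Y) (_ : MulAction G Y) (φ : D.Space → Y) (e : Y ≃ᵐ G ⧸ Γ),
    D.IsFactorMap φ ∧ ∀ (g : G) (y : Y), e (g • y) = g • e y

end CFData

/-!
For a factor map `τ` let `θ_n(c)` be its value at the point `(1, c)` of `X_n`. Equivariance gives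
`θ_n(c) = c_{n+1} ⋯ c_m θ_m(c_{m+1}, c_{m+2}, …)`, so resampling the coordinates after the `m`-th
changes `θ_0` exactly when it changes `θ_m`. Since measurable sets are approximated by cylinders,
the former has probability tending to `0`; hence `θ_m` equals some constant `q_m` with probability
tending to `1`, and `c_{n+1} ⋯ c_m q_m = q_n` with high probability for all large `n < m`. As
`G ⧸ Γ` is finite, `q` is constant along a subsequence, which can be thinned until the exceptional
probabilities are summable. The Borel–Cantelli lemma then shows that `τ` is the limit map of that
telescoping.
-/

section ListProd

variable {M : Type*} [Monoid M]

lemma listProd_mul_listProd (a : ℕ → M) {i j m : ℕ} (hij : i ≤ j) (hjm : j ≤ m) :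
    listProd a i j * listProd a j m = listProd a i m := by
  rw [listProd, listProd, listProd, ← List.prod_append, ← List.map_append,
    List.Ico.append_consecutive hij hjm]

lemma listProd_comp_add_left (a : ℕ → M) (n i j : ℕ) :
    listProd (fun k => a (n + k)) i j = listProd a (n + i) (n + j) := by
  rw [listProd, listProd, add_comm n i, add_comm n j, ← List.Ico.map_add, List.map_map,
    Function.comp_def]

lemma listProd_listProd (a : ℕ → M) {l : ℕ → ℕ} (hl : Monotone l) (m : ℕ) :
    listProd (fun k => listProd a (l k) (l (k + 1))) 0 m = listProd a (l 0) (l m) := by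
  induction m with
  | zero => rw [listProd_self, listProd_self]
  | succ m ih =>
    rw [listProd_succ _ m.zero_le, ih,
      listProd_mul_listProd a (hl m.zero_le) (hl m.le_succ)]

lemma measurable_listProd [MeasurableSpace M] [MeasurableMul₂ M] (n m : ℕ) :
    Measurable fun c : ℕ → M => listProd c n m := by
  unfold listProd
  induction List.Ico n m with
  | nil => exact measurable_const
  | cons a l ih =>
    simp only [List.map_cons, List.prod_cons]
    exact (measurable_pi_apply a).mul ih

/-- The change of coordinates `(f, c 0, c 1, …) ↦ (f * c 0 * ⋯ * c (k-1), c k, c (k+1), …)`, that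
is, the `k`-fold iterate of the embeddings `X_n → X_{n+1}`. -/
def advance (k : ℕ) (p : M × (ℕ → M)) : M × (ℕ → M) :=
  (p.1 * listProd p.2 0 k, fun i => p.2 (k + i))

lemma advance_zero (p : M × (ℕ → M)) : advance 0 p = p := by
  simp only [advance, listProd_self, mul_one, zero_add]

lemma advance_add (j k : ℕ) (p : M × (ℕ → M)) :
    advance (j + k) p = advance k (advance j p) := by
  simp only [advance, listProd_comp_add_left, mul_assoc, add_assoc, add_zero,
    listProd_mul_listProd _ j.zero_le (j.le_add_right k)]

lemma advance_mul_left (g : M) (k : ℕ) (p : M × (ℕ → M)) :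
    advance k (g * p.1, p.2) = (g * (advance k p).1, (advance k p).2) := by
  simp only [advance, mul_assoc]

lemma continuous_advance [TopologicalSpace M] [ContinuousMul M] (k : ℕ) :
    Continuous (advance k : M × (ℕ → M) → M × (ℕ → M)) := by
  have hprod : Continuous fun p : M × (ℕ → M) => listProd p.2 0 k :=
    continuous_list_prod _ fun i _ => by fun_prop
  exact (continuous_fst.mul hprod).prodMk (by fun_prop)

lemma measurable_advance [MeasurableSpace M] [MeasurableMul₂ M] (k : ℕ) :
    Measurable (advance k : M × (ℕ → M) → M × (ℕ → M)) :=
  (measurable_fst.mul ((measurable_listProd 0 k).comp measurable_snd)).prodMk (by fun_prop)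

end ListProd

section ConvProd

variable {G : Type*} [Monoid G] [MeasurableSpace G] (κ : ℕ → Measure G)

lemma convProd_self (n : ℕ) : convProd κ n n = Measure.dirac 1 := by
  simp only [convProd, List.Ico.self_empty, List.map_nil, List.foldl_nil]

lemma convProd_succ {n m : ℕ} (h : n ≤ m) :
    convProd κ n (m + 1) = (convProd κ n m).mconv (κ m) := by
  simp only [convProd, List.Ico.succ_top h, List.map_append, List.map_cons, List.map_nil,
    List.foldl_append, List.foldl_cons, List.foldl_nil]

lemma convProd_comp_add_left (n i j : ℕ) :
    convProd (fun k => κ (n + k)) i j = convProd κ (n + i) (n + j) := by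
  rw [convProd, convProd, add_comm n i, add_comm n j, ← List.Ico.map_add, List.map_map,
    Function.comp_def]

lemma isProbabilityMeasure_convProd [MeasurableMul₂ G] [∀ i, IsProbabilityMeasure (κ i)]
    {n m : ℕ} (h : n ≤ m) : IsProbabilityMeasure (convProd κ n m) := by
  induction m, h using Nat.le_induction with
  | base => rw [convProd_self]; infer_instance
  | succ m h ih => rw [convProd_succ κ h]; infer_instance

end ConvProd

lemma exists_finset_measure_preimage_compl_lt {Ω Q : Type*} [MeasurableSpace Ω] {μ : Measure Ω}
    [IsFiniteMeasure μ] [Countable Q] [MeasurableSpace Q] [MeasurableSingletonClass Q] {θ : Ω → Q}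
    (hθ : Measurable θ) {ε : ℝ≥0∞} (hε : ε ≠ 0) : ∃ s : Finset Q, μ {ω | θ ω ∉ s} < ε := by
  have hlim := tendsto_measure_iInter_atTop (μ := μ) (s := fun s : Finset Q => {ω | θ ω ∉ s})
    (fun s => (hθ s.measurableSet.compl).nullMeasurableSet)
    (fun _ _ hst _ hω hs => hω (hst hs)) ⟨∅, measure_ne_top _ _⟩
  have hempty : ⋂ s : Finset Q, {ω | θ ω ∉ s} = ∅ :=
    eq_empty_of_forall_notMem fun ω hω => mem_iInter.1 hω {θ ω} (Finset.mem_singleton_self _)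
  rw [hempty, measure_empty] at hlim
  exact (hlim.eventually_lt_const hε.bot_lt).exists

section Splice

variable {α : Type*}

/-- The sequence `c 0, …, c (m-1), c' 0, c' 1, …`. Replacing the tail of a random sequence by an
independent copy of it is done with `splice`. -/
def splice (m : ℕ) (c c' : ℕ → α) : ℕ → α := fun i => if i < m then c i else c' (i - m)

lemma splice_of_lt {m i : ℕ} (h : i < m) (c c' : ℕ → α) : splice m c c' i = c i := if_pos h

lemma splice_add (m i : ℕ) (c c' : ℕ → α) : splice m c c' (m + i) = c' i := by
  simp only [splice, Nat.not_lt.2 (m.le_add_right i), if_false, Nat.add_sub_cancel_left]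

lemma listProd_splice {M : Type*} [Monoid M] (m : ℕ) (c c' : ℕ → M) :
    listProd (splice m c c') 0 m = listProd c 0 m :=
  congrArg List.prod <| List.map_congr_left fun _ hi =>
    splice_of_lt (List.Ico.mem.1 hi).2 c c'

lemma splice_mem_pi_iff (m : ℕ) (s : Finset ℕ) (t : ℕ → Set α) (c c' : ℕ → α) :
    splice m c c' ∈ (s : Set ℕ).pi t ↔ c ∈ (s.filter (· < m) : Set ℕ).pi t ∧
      c' ∈ (s.preimage (m + ·) (add_right_injective m).injOn : Set ℕ).pi fun i => t (m + i) := by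
  simp only [Set.mem_pi, Finset.coe_filter, Finset.coe_preimage, mem_preimage, Finset.mem_coe]
  refine ⟨fun h => ⟨fun i hi => splice_of_lt hi.2 c c' ▸ h i hi.1, fun i hi =>
    splice_add m i c c' ▸ h _ hi⟩, fun ⟨h, h'⟩ i hi => ?_⟩
  obtain him | ⟨k, rfl⟩ := (lt_or_ge i m).imp_right Nat.exists_eq_add_of_le
  · exact (splice_of_lt him c c').symm ▸ h i ⟨hi, him⟩
  · exact (splice_add m k c c').symm ▸ h' k hi

variable [MeasurableSpace α]

lemma measurable_splice (m : ℕ) :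
    Measurable fun p : (ℕ → α) × (ℕ → α) => splice m p.1 p.2 := by
  refine measurable_pi_lambda _ fun i => ?_
  unfold splice
  split_ifs <;> fun_prop

variable (κ : ℕ → Measure α) [∀ i, IsProbabilityMeasure (κ i)]

lemma measurePreserving_splice (m : ℕ) :
    MeasurePreserving (fun p : (ℕ → α) × (ℕ → α) => splice m p.1 p.2)
      ((Measure.infinitePi κ).prod (Measure.infinitePi fun i => κ (m + i)))
      (Measure.infinitePi κ) := by
  classical
  refine ⟨measurable_splice m, Measure.eq_infinitePi κ fun s t ht => ?_⟩
  have hpre : (fun p : (ℕ → α) × (ℕ → α) => splice m p.1 p.2) ⁻¹' (s : Set ℕ).pi t =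
      (s.filter (· < m) : Set ℕ).pi t ×ˢ
        (s.preimage (m + ·) (add_right_injective m).injOn : Set ℕ).pi fun i => t (m + i) :=
    Set.ext fun p => splice_mem_pi_iff m s t p.1 p.2
  have hrange : ∀ i, i ∈ range (m + ·) ↔ ¬ i < m := fun i =>
    ⟨fun ⟨k, hk⟩ => by dsimp only at hk; omega, fun h => ⟨i - m, by dsimp only; omega⟩⟩
  rw [Measure.map_apply (measurable_splice m) (.pi s.countable_toSet fun i _ => ht i), hpre,
    Measure.prod_prod, Measure.infinitePi_pi _ fun i _ => ht i,
    Measure.infinitePi_pi (fun i => κ (m + i)) (t := fun i => t (m + i)) fun i _ => ht _,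
    Finset.prod_preimage' (m + ·) s _ fun i => κ i (t i)]
  simp only [hrange]
  exact Finset.prod_filter_mul_prod_filter_not s _ _

lemma measurePreserving_prodMk_tail {β : Type*} [MeasurableSpace β] {k : ℕ} {φ : (ℕ → α) → β}
    (hφ : Measurable φ) (hk : ∀ c c', φ (splice k c c') = φ c) :
    MeasurePreserving (fun c => (φ c, fun i => c (k + i))) (Measure.infinitePi κ)
      (((Measure.infinitePi κ).map φ).prod (Measure.infinitePi fun i => κ (k + i))) := by
  have hm : Measurable fun c : ℕ → α => (φ c, fun i => c (k + i)) := by fun_prop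
  have hcomp : (fun c => (φ c, fun i => c (k + i))) ∘ (fun p => splice k p.1 p.2) =
      Prod.map φ id := by
    funext p
    simp only [Function.comp_apply, hk, splice_add]
    rfl
  have := Measure.isProbabilityMeasure_map (μ := Measure.infinitePi κ) hφ.aemeasurable
  refine ⟨hm, ?_⟩
  conv_lhs => rw [← (measurePreserving_splice κ k).map_eq]
  rw [Measure.map_map hm (measurable_splice k), hcomp, ← Measure.map_prod_map _ _ hφ measurable_id,
    Measure.map_id]

/-- `A` is approximated by cylinders, and `splice m` does not change membership in a cylinder once
`m` exceeds its coordinates. -/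
lemma tendsto_measure_splice_mem_ne {A : Set (ℕ → α)} (hA : MeasurableSet A) :
    Tendsto (fun m => ((Measure.infinitePi κ).prod (Measure.infinitePi fun i => κ (m + i)))
      {p | ¬ (p.1 ∈ A ↔ splice m p.1 p.2 ∈ A)}) atTop (𝓝 0) := by
  refine ENNReal.tendsto_nhds_zero.2 fun ε hε => ?_
  obtain ⟨B, hB, hAB⟩ := exists_measure_symmDiff_lt_of_generateFrom_isSetRing
    (μ := Measure.infinitePi κ) isSetRing_measurableCylinders
    ⟨{univ}, countable_singleton _, singleton_subset_iff.2 (univ_mem_measurableCylinders _),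
      by rw [sUnion_singleton, compl_univ, measure_empty]⟩
    generateFrom_measurableCylinders.symm hA (ENNReal.half_pos hε.ne')
  obtain ⟨I, S, -, rfl⟩ := (mem_measurableCylinders _).1 hB
  have hD : MeasurableSet (symmDiff A (cylinder I S)) :=
    hA.symmDiff (MeasurableSet.of_mem_measurableCylinders hB)
  filter_upwards [eventually_gt_atTop (I.sup id)] with m hm
  have hinv : ∀ c c' : ℕ → α, splice m c c' ∈ cylinder I S ↔ c ∈ cylinder I S := fun c c' => by
    rw [mem_cylinder, mem_cylinder, show I.restrict (splice m c c') = I.restrict c from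
      funext fun i => splice_of_lt ((Finset.le_sup (f := id) i.2).trans_lt hm) c c']
  have hsub : {p : (ℕ → α) × (ℕ → α) | ¬ (p.1 ∈ A ↔ splice m p.1 p.2 ∈ A)} ⊆
      Prod.fst ⁻¹' (symmDiff A (cylinder I S)) ∪
        (fun p => splice m p.1 p.2) ⁻¹' (symmDiff A (cylinder I S)) := fun p hp => by
    have := hinv p.1 p.2
    simp only [mem_ofPred_eq, mem_union, mem_preimage, Set.mem_symmDiff] at hp ⊢
    tauto
  calc _ ≤ Measure.infinitePi κ (symmDiff A (cylinder I S)) +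
        Measure.infinitePi κ (symmDiff A (cylinder I S)) := by
        refine (measure_mono hsub).trans ((measure_union_le _ _).trans_eq ?_)
        rw [measurePreserving_fst.measure_preimage hD.nullMeasurableSet,
          (measurePreserving_splice κ m).measure_preimage hD.nullMeasurableSet]
    _ ≤ ε / 2 + ε / 2 := by rw [symmDiff_comm]; gcongr
    _ = ε := ENNReal.add_halves ε

lemma tendsto_measure_splice_ne {Q : Type*} [Countable Q] [MeasurableSpace Q]
    [MeasurableSingletonClass Q] {θ : (ℕ → α) → Q} (hθ : Measurable θ) :
    Tendsto (fun m => ((Measure.infinitePi κ).prod (Measure.infinitePi fun i => κ (m + i)))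
      {p | θ (splice m p.1 p.2) ≠ θ p.1}) atTop (𝓝 0) := by
  refine ENNReal.tendsto_nhds_zero.2 fun ε hε => ?_
  obtain ⟨s, hs⟩ := exists_finset_measure_preimage_compl_lt (μ := Measure.infinitePi κ) hθ
    (ENNReal.half_pos hε.ne').ne'
  have hlim := tendsto_finsetSum s fun j _ =>
    tendsto_measure_splice_mem_ne κ (hθ (measurableSet_singleton j))
  rw [Finset.sum_const_zero] at hlim
  filter_upwards [ENNReal.tendsto_nhds_zero.1 hlim _ (ENNReal.half_pos hε.ne')] with m hm
  have hsub : {p : (ℕ → α) × (ℕ → α) | θ (splice m p.1 p.2) ≠ θ p.1} ⊆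
      Prod.fst ⁻¹' {c | θ c ∉ s} ∪
        ⋃ j ∈ s, {p | ¬ (p.1 ∈ θ ⁻¹' {j} ↔ splice m p.1 p.2 ∈ θ ⁻¹' {j})} := fun p hp => by
    by_cases hps : θ p.1 ∈ s
    · exact .inr (mem_biUnion hps fun h => hp (h.1 rfl))
    · exact .inl hps
  calc _ ≤ Measure.infinitePi κ {c | θ c ∉ s} + _ := by
        refine (measure_mono hsub).trans ((measure_union_le _ _).trans
          (add_le_add (le_of_eq ?_) (measure_biUnion_finset_le _ _)))
        exact measurePreserving_fst.measure_preimage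
          (hθ s.measurableSet.compl).nullMeasurableSet
    _ ≤ ε / 2 + ε / 2 := add_le_add hs.le hm
    _ = ε := ENNReal.add_halves ε

end Splice

section ConvProd

variable {G : Type*} [Monoid G] [MeasurableSpace G] [MeasurableMul₂ G] (κ : ℕ → Measure G)
  [∀ i, IsProbabilityMeasure (κ i)]

lemma map_listProd_infinitePi (k : ℕ) :
    (Measure.infinitePi κ).map (fun c => listProd c 0 k) = convProd κ 0 k := by
  induction k with
  | zero =>
    simp only [listProd_self, convProd_self, Measure.map_const, measure_univ, one_smul]
  | succ k ih =>
    have hpair := (measurePreserving_prodMk_tail κ (measurable_listProd 0 k)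
      (listProd_splice k)).map_eq
    have hprod : (fun c : ℕ → G => listProd c 0 (k + 1)) =
        ((fun p => p.1 * p.2) ∘ Prod.map id fun c' : ℕ → G => c' 0) ∘
          fun c => (listProd c 0 k, fun i => c (k + i)) :=
      funext fun c => listProd_succ c k.zero_le
    have hk := isProbabilityMeasure_convProd κ k.zero_le
    rw [hprod, ← Measure.map_map (by fun_prop)
        ((measurable_listProd 0 k).prodMk (by fun_prop)), hpair, ih,
      ← Measure.map_map (by fun_prop) (by fun_prop),
      ← Measure.map_prod_map _ _ measurable_id (by fun_prop), Measure.map_id,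
      Measure.infinitePi_map_eval, add_zero, convProd_succ κ k.zero_le, Measure.mconv]

lemma measurePreserving_listProd_tail (k : ℕ) :
    MeasurePreserving (fun c => (listProd c 0 k, fun i => c (k + i))) (Measure.infinitePi κ)
      ((convProd κ 0 k).prod (Measure.infinitePi fun i => κ (k + i))) := by
  rw [← map_listProd_infinitePi]
  exact measurePreserving_prodMk_tail κ (measurable_listProd 0 k) (listProd_splice k)

lemma map_advance_prod_infinitePi (ρ : Measure G) [SFinite ρ] (k : ℕ) :
    (ρ.prod (Measure.infinitePi κ)).map (advance k) =
      (ρ.mconv (convProd κ 0 k)).prod (Measure.infinitePi fun i => κ (k + i)) := by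
  have hk := isProbabilityMeasure_convProd κ k.zero_le
  have hpair := ((MeasurePreserving.id ρ).prod (measurePreserving_listProd_tail κ k)).map_eq
  have hassoc := ((measurePreserving_prodAssoc ρ (convProd κ 0 k)
    (Measure.infinitePi fun i => κ (k + i))).symm _).map_eq
  have hadvance : (advance k : G × (ℕ → G) → _) =
      Prod.map (fun q : G × G => q.1 * q.2) id ∘ MeasurableEquiv.prodAssoc.symm ∘
        Prod.map id fun c : ℕ → G => (listProd c 0 k, fun i => c (k + i)) := rfl
  have hmeas : Measurable fun c : ℕ → G => (listProd c 0 k, fun i => c (k + i)) :=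
    (measurable_listProd 0 k).prodMk (by fun_prop)
  rw [hadvance, ← Measure.map_map (by fun_prop) (by fun_prop), ← Measure.map_map (by fun_prop)
    (by fun_prop), hpair, hassoc, ← Measure.map_prod_map _ _ (by fun_prop) measurable_id,
    Measure.map_id, Measure.mconv]

end ConvProd

namespace CFSeq

variable {G : Type u} [Group G] (S : CFSeq G)

lemma mul_inj {n : ℕ} {f f' c c' : G} (hf : f ∈ S.F n) (hf' : f' ∈ S.F n) (hc : c ∈ S.C n)
    (hc' : c' ∈ S.C n) (h : f * c = f' * c') : f = f' ∧ c = c' := by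
  obtain rfl : c = c' := by_contra fun hne =>
    Set.disjoint_left.1 (S.disjoint n c hc c' hc' hne) (Set.mul_mem_mul hf rfl)
      (h ▸ Set.mul_mem_mul hf' rfl)
  exact ⟨mul_right_cancel h, rfl⟩

lemma exists_listProd_eq {n k : ℕ} {g : G} (hg : g ∈ S.Cprod n (n + k)) :
    ∃ c : ℕ → G, (∀ i < k, c i ∈ S.C (n + i)) ∧ listProd c 0 k = g := by
  induction k generalizing g with
  | zero =>
    rw [add_zero, Cprod_self] at hg
    exact ⟨1, fun i hi => absurd hi i.not_lt_zero, (listProd_self _ 0).trans hg.symm⟩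
  | succ k ih =>
    rw [← add_assoc, S.Cprod_succ (n.le_add_right k)] at hg
    obtain ⟨a, ha, b, hb, rfl⟩ := hg
    obtain ⟨c, hc, rfl⟩ := ih ha
    refine ⟨splice k c fun _ => b, fun i hi => ?_, ?_⟩
    · obtain hik | rfl := Nat.lt_succ_iff_lt_or_eq.1 hi
      · exact (splice_of_lt hik c _).symm ▸ hc i hik
      · exact (splice_add i 0 c fun _ => b).symm ▸ hb
    · rw [listProd_succ _ k.zero_le, listProd_splice]
      exact congrArg _ (splice_add k 0 c fun _ => b)

/-! ### The levels of the inductive limit -/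

lemma advance_mem_levelSet {n : ℕ} {p : G × (ℕ → G)} (hp : p ∈ S.levelSet n) (k : ℕ) :
    advance k p ∈ S.levelSet (n + k) := by
  refine ⟨S.mul_Cprod_subset (n.le_add_right k) (Set.mul_mem_mul hp.1 ?_), fun i => ?_⟩
  · exact S.listProd_mem_Cprod n p.2 hp.2 k.zero_le
  · exact (add_assoc n k i).symm ▸ hp.2 (k + i)

lemma advance_injOn (n k : ℕ) : InjOn (advance k) (S.levelSet n) := by
  induction k with
  | zero => exact (injOn_id _).congr fun p _ => (advance_zero p).symm
  | succ k ih =>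
    have hone : InjOn (advance 1) (S.levelSet (n + k)) := by
      rintro ⟨f, c⟩ hp ⟨f', c'⟩ hq h
      have hfst : f * c 0 = f' * c' 0 := by
        simpa only [advance, listProd_succ _ le_rfl, listProd_self, one_mul]
          using congrArg Prod.fst h
      obtain ⟨rfl, hzero⟩ := S.mul_inj hp.1 hq.1 (hp.2 0) (hq.2 0) hfst
      refine Prod.ext rfl (funext fun i => ?_)
      cases i with
      | zero => exact hzero
      | succ i => simpa only [advance, add_comm] using congrFun (congrArg Prod.snd h) i
    have hcomp : (advance (k + 1) : G × (ℕ → G) → _) = advance 1 ∘ advance k :=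
      funext (advance_add k 1)
    rw [hcomp]
    exact hone.comp ih fun p hp => S.advance_mem_levelSet hp k

lemma image_advance_levelSet (n k : ℕ) :
    advance k '' S.levelSet n = {p ∈ S.levelSet (n + k) | p.1 ∈ S.F n * S.Cprod n (n + k)} := by
  refine Subset.antisymm ?_ ?_
  · rintro _ ⟨p, hp, rfl⟩
    exact ⟨S.advance_mem_levelSet hp k,
      Set.mul_mem_mul hp.1 (S.listProd_mem_Cprod n p.2 hp.2 k.zero_le)⟩
  · rintro ⟨g, c⟩ ⟨⟨-, hc⟩, f, hf, a, ha, hfa⟩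
    obtain ⟨a, hmem, rfl⟩ := S.exists_listProd_eq ha
    obtain rfl : f * listProd a 0 k = g := hfa
    refine ⟨(f, splice k a c), ⟨hf, fun i => ?_⟩,
      Prod.ext (by simp only [advance, listProd_splice]) (funext fun i => splice_add k i a c)⟩
    obtain hik | ⟨j, rfl⟩ := (lt_or_ge i k).imp_right Nat.exists_eq_add_of_le
    · exact mem_of_eq_of_mem (splice_of_lt hik a c) (hmem i hik)
    · exact mem_of_eq_of_mem (splice_add k j a c) (add_assoc n k j ▸ hc j)

/-- The embedding `X_n → X_{n+k}` of the inductive system. -/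
def advanceLevel (n k : ℕ) (p : S.Level n) : S.Level (n + k) :=
  ⟨advance k p.1, S.advance_mem_levelSet p.2 k⟩

lemma advanceLevel_injective (n k : ℕ) : Function.Injective (S.advanceLevel n k) := fun p q h =>
  Subtype.ext (S.advance_injOn n k p.2 q.2 (congrArg Subtype.val h))

lemma range_advanceLevel (n k : ℕ) :
    range (S.advanceLevel n k) = {p | p.1.1 ∈ S.F n * S.Cprod n (n + k)} := by
  ext p
  have hp : p.1 ∈ advance k '' S.levelSet n ↔ _ := Set.ext_iff.1 (S.image_advance_levelSet n k) p.1
  simp only [mem_ofPred_eq, p.2, true_and] at hp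
  rw [mem_ofPred_eq, ← hp]
  exact ⟨fun ⟨q, hq⟩ => ⟨q.1, q.2, congrArg Subtype.val hq⟩,
    fun ⟨q, hq, h⟩ => ⟨⟨q, hq⟩, Subtype.ext h⟩⟩

lemma val_embed (n : ℕ) (p : S.Level n) : (S.embed n p).1 = advance 1 p.1 := by
  simp only [embed, advance, listProd_succ _ le_rfl, listProd_self, one_mul, add_comm 1]

lemma incl_advanceLevel (n k : ℕ) (p : S.Level n) :
    S.incl (n + k) (S.advanceLevel n k p) = S.incl n p := by
  induction k with
  | zero => exact congrArg (S.incl n) (Subtype.ext (advance_zero _))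
  | succ k ih =>
    have hsucc : S.advanceLevel n (k + 1) p = S.embed (n + k) (S.advanceLevel n k p) :=
      Subtype.ext ((advance_add k 1 p.1).trans (S.val_embed (n + k) (S.advanceLevel n k p)).symm)
    rw [← ih, ← S.incl_embed (n + k), ← hsucc]
    rfl

lemma exists_incl (x : S.Space) : ∃ n, ∃ p : S.Level n, S.incl n p = x :=
  have ⟨a, ha⟩ := Quot.exists_rep x
  ⟨a.1, a.2, ha⟩

/-- The germ at infinity of the sequence of coordinates of `x ∈ X` in `X_k`, for `k` large. It
serves to separate the points of the inductive limit. -/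
def tailGerm (x : S.Space) : Germ (atTop : Filter ℕ) (G × (ℕ → G)) :=
  Quot.lift (fun a : Σ n, S.Level n => ((fun k => advance (k - a.1) a.2.1 : ℕ → _) : Germ atTop _))
    (by
      rintro ⟨n, p⟩ _ rfl
      refine Germ.coe_eq.2 ?_
      filter_upwards [eventually_ge_atTop (n + 1)] with k hk
      rw [val_embed, ← advance_add, show k - n = 1 + (k - (n + 1)) by omega]) x

lemma eventually_advance_eq {n m : ℕ} {p : S.Level n} {q : S.Level m}
    (h : S.incl n p = S.incl m q) : ∀ᶠ k in atTop, advance (k - n) p.1 = advance (k - m) q.1 :=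
  Germ.coe_eq.1 (congrArg S.tailGerm h)

lemma incl_injective (n : ℕ) : Function.Injective (S.incl n) := fun p q h =>
  have ⟨_, hk⟩ := (S.eventually_advance_eq h).exists
  Subtype.ext (S.advance_injOn n _ p.2 q.2 hk)

lemma incl_eq_incl_add_iff {n k : ℕ} {p : S.Level n} {q : S.Level (n + k)} :
    S.incl n p = S.incl (n + k) q ↔ S.advanceLevel n k p = q := by
  rw [← S.incl_advanceLevel n k, (S.incl_injective _).eq_iff]

/-! ### The topology of the inductive limit -/

variable [TopologicalSpace G]

lemma isOpen_iff {A : Set S.Space} : IsOpen A ↔ ∀ n, IsOpen (S.incl n ⁻¹' A) :=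
  isOpen_sigma_iff (s := Quot.mk _ ⁻¹' A)

lemma continuous_incl (n : ℕ) : Continuous (S.incl n) :=
  ⟨fun _ hA => S.isOpen_iff.1 hA n⟩

instance (n : ℕ) : CompactSpace (S.Level n) := by
  have hlevel : S.levelSet n = S.F n ×ˢ univ.pi fun i => S.C (n + i) := by
    ext p
    simp only [levelSet, mem_ofPred_eq, mem_prod, mem_univ_pi]
  refine isCompact_iff_compactSpace.1 ?_
  rw [hlevel]
  exact (S.finite_F n).isCompact.prod (isCompact_univ_pi fun i => (S.finite_C _).isCompact)

variable [DiscreteTopology G]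

lemma isOpenEmbedding_advanceLevel (n k : ℕ) : IsOpenEmbedding (S.advanceLevel n k) where
  toIsEmbedding := by
    have hcont : Continuous (S.advanceLevel n k) :=
      ((continuous_advance k).comp continuous_subtype_val).subtype_mk _
    exact (hcont.isClosedEmbedding (S.advanceLevel_injective n k)).isEmbedding
  isOpen_range := by
    rw [range_advanceLevel]
    exact (isOpen_discrete (S.F n * S.Cprod n (n + k))).preimage (by fun_prop :
      Continuous fun p : S.Level (n + k) => p.1.1)

lemma isOpenEmbedding_incl (n : ℕ) : IsOpenEmbedding (S.incl n) := by
  refine .of_continuous_injective_isOpenMap (S.continuous_incl n) (S.incl_injective n) fun U hU =>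
    S.isOpen_iff.2 fun m => ?_
  obtain ⟨k, rfl⟩ | ⟨k, rfl⟩ := (le_total n m).imp Nat.exists_eq_add_of_le Nat.exists_eq_add_of_le
  · have hpre : S.incl (n + k) ⁻¹' (S.incl n '' U) = S.advanceLevel n k '' U := by
      ext q
      simp only [mem_preimage, mem_image, incl_eq_incl_add_iff]
    exact hpre ▸ (S.isOpenEmbedding_advanceLevel n k).isOpenMap U hU
  · have hpre : S.incl m ⁻¹' (S.incl (m + k) '' U) = S.advanceLevel m k ⁻¹' U := by
      ext p
      rw [mem_preimage, ← S.incl_advanceLevel m k, (S.incl_injective _).mem_set_image,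
        mem_preimage]
    exact hpre ▸ hU.preimage (S.isOpenEmbedding_advanceLevel m k).continuous

end CFSeq

namespace CFSeq

variable {G : Type u} [Group G] (S : CFSeq G)

lemma incl_mul_left_congr {g : G} {n m : ℕ} {p : S.Level n} {q : S.Level m}
    (h : S.incl n p = S.incl m q) (hp : g * p.1.1 ∈ S.F n) (hq : g * q.1.1 ∈ S.F m) :
    S.incl n ⟨(g * p.1.1, p.1.2), hp, p.2.2⟩ = S.incl m ⟨(g * q.1.1, q.1.2), hq, q.2.2⟩ := by
  wlog hnm : n ≤ m generalizing n m
  · exact (this h.symm hq hp (le_of_not_ge hnm)).symm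
  obtain ⟨k, rfl⟩ := Nat.exists_eq_add_of_le hnm
  obtain rfl := S.incl_eq_incl_add_iff.1 h
  exact S.incl_eq_incl_add_iff.2 (Subtype.ext (advance_mul_left g k p.1))

lemma act_incl (g : G) {n : ℕ} (p : S.Level n) (hp : S.incl n p ∈ S.fullDomain)
    (hg : g * p.1.1 ∈ S.F n) :
    S.act g (S.incl n p) = S.incl n ⟨(g * p.1.1, p.1.2), hg, p.2.2⟩ := by
  rw [act, dif_pos hp]
  have hrep := (mem_iInter.1 hp g).choose_spec.choose_spec
  exact S.incl_mul_left_congr hrep.1.symm hrep.2 hg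

/-- The canonical map `X_n → X` in coordinates, extended to all pairs `(f, c)` by a junk value. -/
noncomputable def point (n : ℕ) : G × (ℕ → G) → S.Space :=
  Function.extend Subtype.val (S.incl n) fun _ =>
    S.incl n ⟨(1, fun _ => 1), S.one_mem_F n, fun _ => S.one_mem_C _⟩

lemma point_val (n : ℕ) (p : S.Level n) : S.point n p.1 = S.incl n p :=
  Subtype.val_injective.extend_apply _ _ p

lemma point_of_mem {n : ℕ} {p : G × (ℕ → G)} (hp : p ∈ S.levelSet n) :
    S.point n p = S.incl n ⟨p, hp⟩ :=
  S.point_val n ⟨p, hp⟩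

lemma point_advance {n : ℕ} {p : G × (ℕ → G)} (hp : p ∈ S.levelSet n) (k : ℕ) :
    S.point (n + k) (advance k p) = S.point n p := by
  rw [S.point_of_mem hp, S.point_of_mem (S.advance_mem_levelSet hp k)]
  exact S.incl_advanceLevel n k ⟨p, hp⟩

lemma point_mem_range_incl_iff {n k : ℕ} {p : G × (ℕ → G)} (hp : p ∈ S.levelSet (n + k)) :
    S.point (n + k) p ∈ range (S.incl n) ↔ p.1 ∈ S.F n * S.Cprod n (n + k) := by
  have hrange := Set.ext_iff.1 (S.range_advanceLevel n k) ⟨p, hp⟩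
  rw [mem_ofPred_eq] at hrange
  simp only [S.point_of_mem hp, mem_range, incl_eq_incl_add_iff, ← hrange]

lemma measurableSet_levelSet [MeasurableSpace G] [DiscreteMeasurableSpace G] (n : ℕ) :
    MeasurableSet (S.levelSet n) := by
  have hlevel : S.levelSet n = S.F n ×ˢ univ.pi fun i => S.C (n + i) := by
    ext p
    simp only [levelSet, mem_ofPred_eq, mem_prod, mem_univ_pi]
  rw [hlevel]
  exact MeasurableSet.of_discrete.prod (.univ_pi fun _ => .of_discrete)

variable [TopologicalSpace G] [DiscreteTopology G] [Countable G] [MeasurableSpace G] [BorelSpace G]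

lemma measurableEmbedding_incl (n : ℕ) : MeasurableEmbedding (S.incl n) :=
  (S.isOpenEmbedding_incl n).measurableEmbedding

lemma measurable_point (n : ℕ) : Measurable (S.point n) :=
  (MeasurableEmbedding.subtype_coe (S.measurableSet_levelSet n)).measurable_extend
    (S.measurableEmbedding_incl n).measurable measurable_const

end CFSeq

lemma restrict_sum_restrict_disjointed {α : Type*} [MeasurableSpace α] {ρ : ℕ → Measure α}
    {A : ℕ → Set α} (hA : ∀ n, MeasurableSet (A n)) {n : ℕ}
    (hρ : ∀ k ≤ n, ρ k = (ρ n).restrict (A k)) :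
    (Measure.sum fun k => (ρ k).restrict (disjointed A k)).restrict (A n) = ρ n := by
  have hdisj := MeasurableSet.disjointed hA
  have hterm : ∀ k, ((ρ k).restrict (disjointed A k)).restrict (A n) =
      (ρ n).restrict (disjointed A k ∩ A n) := fun k => by
    rw [Measure.restrict_restrict (hA n)]
    obtain hkn | hnk := le_or_gt k n
    · rw [hρ k hkn, Measure.restrict_restrict ((hA n).inter (hdisj k)),
        inter_eq_left.2 (inter_subset_right.trans (disjointed_subset A k)), inter_comm]
    · have hdisj' : Disjoint (A n) (disjointed A k) := by
        rw [disjointed_eq_inter_compl]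
        exact Set.disjoint_left.2 fun x hx hxk => mem_iInter₂.1 hxk.2 n hnk hx
      rw [hdisj'.inter_eq, hdisj'.symm.inter_eq, Measure.restrict_empty, Measure.restrict_empty]
  have hunion : ⋃ k, disjointed A k ∩ A n = A n := by
    rw [← iUnion_inter, iUnion_disjointed, inter_eq_right]
    exact subset_iUnion A n
  rw [Measure.restrict_sum_of_countable, funext hterm, ← Measure.restrict_iUnion, hunion,
    ← hρ n le_rfl]
  · exact fun i j hij => (disjoint_disjointed A hij).mono inter_subset_left inter_subset_left
  · exact fun k => (hdisj k).inter (hA n)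

namespace CFData

variable {G : Type u} [Group G] [MeasurableSpace G] (D : CFData G)

/-- The measure `κ_{n+1} ⊗ κ_{n+2} ⊗ ⋯`. -/
noncomputable def seqMeasure (n : ℕ) : Measure (ℕ → G) := Measure.infinitePi fun i => D.κ (n + i)

/-- The measure `ν_n ⊗ κ_{n+1} ⊗ κ_{n+2} ⊗ ⋯` on all pairs `(f, c)`; it lives on `X_n`. -/
noncomputable def prodMeasure (n : ℕ) : Measure (G × (ℕ → G)) := (D.ν n).prod (D.seqMeasure n)

namespace Admissible

variable {D} (hD : D.Admissible)
include hD

lemma isProbabilityMeasure_seqMeasure (n : ℕ) : IsProbabilityMeasure (D.seqMeasure n) := by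
  have := hD.prob_κ
  unfold seqMeasure
  infer_instance

lemma ae_mem_C (n : ℕ) : ∀ᵐ c ∂D.seqMeasure n, ∀ i, c i ∈ D.C (n + i) := by
  have := hD.prob_κ
  refine ae_all_iff.2 fun i => ae_of_ae_map (measurable_pi_apply i).aemeasurable ?_
  rw [seqMeasure, Measure.infinitePi_map_eval]
  exact hD.supp_κ (n + i)

lemma ae_mem_levelSet (n : ℕ) : ∀ᵐ p ∂D.prodMeasure n, p ∈ D.levelSet n := by
  have := hD.isProbabilityMeasure_seqMeasure
  have := hD.fin_ν
  have hF : ∀ᵐ f ∂D.ν n, f ∈ D.F n := hD.supp_ν n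
  filter_upwards [Measure.quasiMeasurePreserving_fst.ae hF,
    Measure.quasiMeasurePreserving_snd.ae (hD.ae_mem_C n)] with p hf hc using ⟨hf, hc⟩

lemma ae_seqMeasure_of_ae {n : ℕ} {P : G × (ℕ → G) → Prop} (h : ∀ᵐ p ∂D.prodMeasure n, P p)
    {f : G} (hf : f ∈ D.F n) : ∀ᵐ c ∂D.seqMeasure n, P (f, c) := by
  have := hD.isProbabilityMeasure_seqMeasure
  by_contra hc
  exact (hD.pos_ν n f hf).ne'
    (measure_mono_null (singleton_subset_iff.2 hc) (Measure.ae_ae_of_ae_prod h))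

variable [Countable G] [DiscreteMeasurableSpace G]

lemma isProbabilityMeasure_κprod (n k : ℕ) : IsProbabilityMeasure (D.κprod n (n + k)) :=
  have := hD.prob_κ
  isProbabilityMeasure_convProd D.κ (n.le_add_right k)

lemma measurePreserving_listProd_shift (n k : ℕ) :
    MeasurePreserving (fun c : ℕ → G => (listProd c 0 k, fun i => c (k + i)))
      (D.seqMeasure n) ((D.κprod n (n + k)).prod (D.seqMeasure (n + k))) := by
  have := hD.prob_κ
  have h := measurePreserving_listProd_tail (fun i => D.κ (n + i)) k
  simp only [convProd_comp_add_left, add_zero, ← add_assoc] at h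
  exact h

lemma restrict_mconv {n : ℕ} {A : Set G} (hA : A ⊆ D.F n) :
    ((D.ν n).restrict A).mconv (D.κ n) = (D.ν (n + 1)).restrict (A * D.C n) := by
  have := hD.prob_κ
  have := hD.fin_ν
  have hAae : ∀ᵐ f ∂(D.ν n).restrict A, f ∈ A := ae_restrict_mem .of_discrete
  have hCae : ∀ᵐ c ∂D.κ n, c ∈ D.C n := hD.supp_κ n
  have hae : ∀ᵐ q ∂((D.ν n).restrict A).prod (D.κ n), q.1 ∈ A ∧ q.2 ∈ D.C n :=
    (Measure.quasiMeasurePreserving_fst.ae hAae).and (Measure.quasiMeasurePreserving_snd.ae hCae)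
  refine Measure.ext_of_singleton fun x => ?_
  rw [Measure.mconv, Measure.map_apply measurable_mul (measurableSet_singleton x),
    Measure.restrict_apply (measurableSet_singleton x)]
  by_cases hx : x ∈ A * D.C n
  · obtain ⟨f, hf, c, hc, rfl⟩ := hx
    have hfib : (fun q : G × G => q.1 * q.2) ⁻¹' {f * c} =ᵐ[((D.ν n).restrict A).prod (D.κ n)]
        ({f} ×ˢ {c} : Set (G × G)) := by
      filter_upwards [hae] with q hq
      exact propext ⟨fun h => D.mul_inj (hA hq.1) (hA hf) hq.2 hc h,
        fun h => congrArg₂ (· * ·) h.1 h.2⟩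
    rw [measure_congr hfib, Measure.prod_prod, Measure.restrict_apply (measurableSet_singleton f),
      inter_eq_left.2 (singleton_subset_iff.2 hf),
      inter_eq_left.2 (singleton_subset_iff.2 (Set.mul_mem_mul hf hc)), hD.ν_mul n f (hA hf) c hc]
  · rw [singleton_inter_eq_empty.2 hx, measure_empty]
    refine measure_mono_null (fun q hq => ?_) hae
    exact fun hmem => hx (hq ▸ Set.mul_mem_mul hmem.1 hmem.2)

lemma ν_mconv (n k : ℕ) :
    (D.ν n).mconv (D.κprod n (n + k)) =
      (D.ν (n + k)).restrict (D.F n * D.Cprod n (n + k)) := by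
  have := hD.prob_κ
  have := hD.fin_ν
  induction k with
  | zero =>
    rw [add_zero, κprod, convProd_self, Measure.mconv_dirac_one, CFSeq.Cprod_self, singleton_one,
      mul_one, Measure.restrict_eq_self_of_ae_mem (hD.supp_ν n)]
  | succ k ih =>
    have := hD.isProbabilityMeasure_κprod n k
    have hκ : D.κprod n (n + k + 1) = (D.κprod n (n + k)).mconv (D.κ (n + k)) :=
      convProd_succ D.κ (n.le_add_right k)
    rw [← add_assoc, hκ, ← Measure.mconv_assoc, ih,
      hD.restrict_mconv (D.mul_Cprod_subset (n.le_add_right k)),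
      D.Cprod_succ (n.le_add_right k), mul_assoc]

lemma map_advance_prodMeasure (n k : ℕ) :
    (D.prodMeasure n).map (advance k) =
      (D.prodMeasure (n + k)).restrict ((D.F n * D.Cprod n (n + k)) ×ˢ univ) := by
  have := hD.prob_κ
  have := hD.fin_ν
  have := hD.isProbabilityMeasure_seqMeasure
  have h := map_advance_prod_infinitePi (fun i => D.κ (n + i)) (D.ν n) k
  simp only [convProd_comp_add_left, add_zero, ← add_assoc] at h
  rw [prodMeasure, prodMeasure, ← Measure.prod_restrict, Measure.restrict_univ, ← hD.ν_mconv]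
  exact h

end Admissible

end CFData

/-! ### The measure on the inductive limit -/

namespace CFData.Admissible

section Discrete

variable {G : Type u} [Group G] [Countable G] [MeasurableSpace G] [DiscreteMeasurableSpace G]
  {D : CFData G} (hD : D.Admissible)
include hD

lemma prodMeasure_advance_fst_mem (n k : ℕ) (E : Set G) :
    D.prodMeasure n {p | (advance k p).1 ∈ E} = D.ν (n + k) (E ∩ (D.F n * D.Cprod n (n + k))) := by
  have := hD.fin_ν
  have := hD.isProbabilityMeasure_seqMeasure
  have hE : MeasurableSet (E ×ˢ univ : Set (G × (ℕ → G))) := MeasurableSet.of_discrete.prod .univ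
  have hpre : {p : G × (ℕ → G) | (advance k p).1 ∈ E} = advance k ⁻¹' (E ×ˢ univ) := by
    ext p
    simp only [mem_ofPred_eq, mem_preimage, mem_prod, mem_univ, and_true]
  rw [hpre, ← Measure.map_apply (measurable_advance k) hE, hD.map_advance_prodMeasure,
    Measure.restrict_apply hE, prod_inter_prod, univ_inter, prodMeasure, Measure.prod_prod,
    measure_univ, mul_one]

lemma ν_mul_Cprod (n k : ℕ) : D.ν (n + k) (D.F n * D.Cprod n (n + k)) = D.ν n (D.F n) := by
  have := hD.fin_ν
  have := hD.isProbabilityMeasure_seqMeasure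
  have huniv : D.ν n univ = D.ν n (D.F n) :=
    measure_congr (eventuallyEq_univ.2 (hD.supp_ν n)).symm
  have h := hD.prodMeasure_advance_fst_mem n k univ
  rw [univ_inter] at h
  rw [← h, ← huniv]
  simp only [mem_univ, prodMeasure, ofPred_true, ← univ_prod_univ, Measure.prod_prod, measure_univ,
    mul_one]

lemma tendsto_prodMeasure_mul_advance_notMem (g : G) (n : ℕ) :
    Tendsto (fun k => D.prodMeasure n {p | g * (advance k p).1 ∉ D.F (n + k)}) atTop (𝓝 0) := by
  have := hD.fin_ν
  let A : ℕ → Set G := fun k => D.F n * D.Cprod n (n + k)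
  let B : ℕ → Set G := fun k => g⁻¹ • D.F (n + k)
  have hB : ∀ k, D.prodMeasure n {p | g * (advance k p).1 ∉ D.F (n + k)} =
      D.ν n (D.F n) - D.ν (n + k) (A k ∩ B k) := fun k => by
    have hcompl : {p : G × (ℕ → G) | g * (advance k p).1 ∉ D.F (n + k)} =
        {p | (advance k p).1 ∈ (B k)ᶜ} := by
      ext p
      simp only [B, mem_ofPred_eq, mem_compl_iff, mem_inv_smul_set_iff, smul_eq_mul]
    rw [hcompl, hD.prodMeasure_advance_fst_mem, ← hD.ν_mul_Cprod n k, inter_comm, ← sdiff_eq,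
      ← sdiff_self_inter, measure_sdiff inter_subset_left
        MeasurableSet.of_discrete.nullMeasurableSet (measure_ne_top _ _)]
  have hfull : Tendsto (fun k => D.ν (n + k) (A k ∩ B k)) atTop (𝓝 (D.ν n (D.F n))) :=
    (hD.full g n).comp (tendsto_atTop_mono (fun k => Nat.le_add_left k n) tendsto_id)
  simpa only [hB, tsub_self] using
    ENNReal.Tendsto.sub (tendsto_const_nhds (x := D.ν n (D.F n))) hfull (.inl (measure_ne_top _ _))

lemma ae_exists_mul_advance_mem (g : G) (n : ℕ) :
    ∀ᵐ p ∂D.prodMeasure n, ∃ k, g * (advance k p).1 ∈ D.F (n + k) := by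
  refine le_antisymm (ge_of_tendsto' (hD.tendsto_prodMeasure_mul_advance_notMem g n) fun k =>
    measure_mono fun p hp => ?_) zero_le
  exact fun hk => hp ⟨k, hk⟩

end Discrete

variable {G : Type u} [Group G] [Countable G] [TopologicalSpace G] [DiscreteTopology G]
  [MeasurableSpace G] [BorelSpace G] {D : CFData G} (hD : D.Admissible)
include hD

lemma map_val_levelMeasure (n : ℕ) : (D.levelMeasure n).map Subtype.val = D.prodMeasure n :=
  ((MeasurableEmbedding.subtype_coe (D.measurableSet_levelSet n)).map_comap _).trans
    (Measure.restrict_eq_self_of_ae_mem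
      ((hD.ae_mem_levelSet n).mono fun _ hp => Subtype.range_coe.symm ▸ hp))

lemma map_incl_levelMeasure (n : ℕ) :
    (D.levelMeasure n).map (D.incl n) = (D.prodMeasure n).map (D.point n) := by
  rw [← hD.map_val_levelMeasure, Measure.map_map (D.measurable_point n) measurable_subtype_coe]
  exact congrArg (Measure.map · _) (funext fun p => (D.point_val n p).symm)

lemma map_point_prodMeasure (n k : ℕ) :
    (D.prodMeasure n).map (D.point n) =
      ((D.prodMeasure (n + k)).map (D.point (n + k))).restrict (range (D.incl n)) := by
  have hadvance : D.point n =ᵐ[D.prodMeasure n] D.point (n + k) ∘ advance k :=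
    (hD.ae_mem_levelSet n).mono fun p hp => (D.point_advance hp k).symm
  have hrange : D.point (n + k) ⁻¹' range (D.incl n) =ᵐ[D.prodMeasure (n + k)]
      ((D.F n * D.Cprod n (n + k)) ×ˢ univ : Set (G × (ℕ → G))) :=
    (hD.ae_mem_levelSet (n + k)).mono fun p hp =>
      propext ((D.point_mem_range_incl_iff hp).trans (and_iff_left (mem_univ _)).symm)
  rw [Measure.map_congr hadvance, ← Measure.map_map (D.measurable_point _) (measurable_advance k),
    hD.map_advance_prodMeasure, ← Measure.restrict_congr_set hrange, Measure.restrict_map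
      (D.measurable_point _) (D.measurableEmbedding_incl n).measurableSet_range]

lemma restrict_μ_range_incl (n : ℕ) :
    D.μ.restrict (range (D.incl n)) = (D.prodMeasure n).map (D.point n) := by
  rw [μ]
  simp only [hD.map_incl_levelMeasure]
  refine restrict_sum_restrict_disjointed
    (fun m => (D.measurableEmbedding_incl m).measurableSet_range) fun m hm => ?_
  obtain ⟨k, rfl⟩ := Nat.exists_eq_add_of_le hm
  exact hD.map_point_prodMeasure m k

lemma ae_μ_iff {P : D.Space → Prop} :
    (∀ᵐ x ∂D.μ, P x) ↔ ∀ n, ∀ᵐ p ∂D.prodMeasure n, P (D.point n p) := by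
  have hunion : ⋃ n, range (D.incl n) = univ := eq_univ_of_forall fun x =>
    have ⟨n, p, hp⟩ := D.exists_incl x
    mem_iUnion.2 ⟨n, p, hp⟩
  rw [← Measure.restrict_univ (μ := D.μ), ← hunion, ae_restrict_iUnion_iff]
  refine forall_congr' fun n => ?_
  rw [hD.restrict_μ_range_incl, ← hD.map_incl_levelMeasure,
    (D.measurableEmbedding_incl n).ae_map_iff, ← hD.map_val_levelMeasure,
    (MeasurableEmbedding.subtype_coe (D.measurableSet_levelSet n)).ae_map_iff]
  simp only [D.point_val]

lemma ae_mem_fullDomain : ∀ᵐ x ∂D.μ, x ∈ D.fullDomain := by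
  refine hD.ae_μ_iff.2 fun n => ?_
  filter_upwards [hD.ae_mem_levelSet n, ae_all_iff.2 fun g => hD.ae_exists_mul_advance_mem g n]
    with p hp hadv
  refine mem_iInter.2 fun g => ?_
  obtain ⟨k, hk⟩ := hadv g
  rw [← D.point_advance hp k, D.point_of_mem (D.advance_mem_levelSet hp k)]
  exact ⟨n + k, _, rfl, hk⟩

end CFData.Admissible

/-! ### Limits in the coset space -/

section Coset

variable {G : Type*} [Group G] {Γ : Subgroup G}

lemma smul_mk_eq_mk_iff (c g h : G) : c • (g : G ⧸ Γ) = (h : G ⧸ Γ) ↔ h⁻¹ * c * g ∈ Γ := by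
  rw [eq_comm, MulAction.Quotient.smul_coe, smul_eq_mul, QuotientGroup.eq, mul_assoc]

lemma mem_map_conj_iff (c g : G) :
    c ∈ Γ.map (MulAut.conj g).toMonoidHom ↔ c • (g : G ⧸ Γ) = g := by
  rw [smul_mk_eq_mk_iff, ← MulAut.conj_symm_apply]
  exact Subgroup.mem_map_equiv

lemma mem_inv_mul_mul_iff (c g h : G) :
    c ∈ ({g⁻¹} * (Γ : Set G) * {h} : Set G) ↔
      c • ((h⁻¹ : G) : G ⧸ Γ) = ((g⁻¹ : G) : G ⧸ Γ) := by
  rw [smul_mk_eq_mk_iff, inv_inv, mul_singleton, singleton_mul, image_mul_right, mem_preimage,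
    image_mul_left, mem_preimage, inv_inv, mul_assoc, SetLike.mem_coe]

end Coset

lemma measurable_of_measurableSet_graph {α Y : Type*} [MeasurableSpace α] [Countable Y]
    [MeasurableSpace Y] {R : α → Y → Prop} (hR : ∀ y, MeasurableSet {x | R x y}) {φ : α → Y}
    {y₀ : Y} (hφ : ∀ x y, R x y → φ x = y) (hφ₀ : ∀ x, (∀ y, ¬ R x y) → φ x = y₀) :
    Measurable φ := by
  refine measurable_to_countable' fun y => ?_
  have hfiber : φ ⁻¹' {y} = {x | R x y} ∪ ({_x | y₀ = y} ∩ ⋂ z, {x | R x z}ᶜ) := by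
    ext x
    constructor
    · rintro (hx : φ x = y)
      by_cases hex : ∃ z, R x z
      · obtain ⟨z, hz⟩ := hex
        exact .inl (((hφ x z hz).symm.trans hx) ▸ hz)
      · have hnone := not_exists.1 hex
        exact .inr ⟨(hφ₀ x hnone).symm.trans hx, mem_iInter.2 hnone⟩
    · rintro (hx | ⟨hy, hx⟩)
      · exact hφ x y hx
      · exact (hφ₀ x (mem_iInter.1 hx)).trans hy
  rw [hfiber]
  exact (hR y).union ((MeasurableSet.const _).inter (.iInter fun z => (hR z).compl))

namespace CFSeq

variable {G : Type u} [Group G] (S : CFSeq G)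

lemma advance_telescopeLevel_fst {l : ℕ → ℕ} (hl : IsTelescopingSeq l) {n : ℕ}
    (p : S.Level (l n)) (m : ℕ) :
    (advance m (S.telescopeLevel l hl n p).1).1 = (advance (l (n + m) - l n) p.1).1 := by
  have hmono : Monotone fun i => l (n + i) - l n := fun i j hij =>
    Nat.sub_le_sub_right (hl.strictMono.monotone (Nat.add_le_add_left hij n)) _
  have h := listProd_listProd p.1.2 hmono m
  rw [add_zero, Nat.sub_self] at h
  exact congrArg (p.1.1 * ·) h

section FactorValue

variable [TopologicalSpace G] [DiscreteTopology G] {Γ : Subgroup G} {q j : G ⧸ Γ}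

lemma isFactorValue_incl_iff {n : ℕ} {p : S.Level n} :
    S.IsFactorValue q (S.incl n p) j ↔ ∀ᶠ k in atTop, (advance (k - n) p.1).1 • q = j := by
  have := QuotientGroup.discreteTopology (isOpen_discrete (Γ : Set G))
  have hlim (m : ℕ) (r : S.Level m) :
      Tendsto (fun k => (advance k r.1).1 • q) atTop (𝓝 j) ↔
        ∀ᶠ k in atTop, (advance (k - m) r.1).1 • q = j := by
    rw [nhds_discrete, tendsto_pure]
    conv_lhs => rw [← map_sub_atTop_eq_nat m, eventually_map]
  refine ⟨?_, fun h => ⟨n, p, rfl, (hlim n p).2 h⟩⟩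
  rintro ⟨m, r, e, hr⟩
  filter_upwards [(hlim m r).1 hr, S.eventually_advance_eq e] with k hk hadv
  rw [hadv, hk]

lemma isFactorValue_iota_incl_iff {l : ℕ → ℕ} (hl : IsTelescopingSeq l) {n : ℕ}
    {p : S.Level n} :
    (S.telescope l hl).IsFactorValue q (S.iota l hl (S.incl n p)) j ↔
      ∀ᶠ k in atTop, (advance (l k - n) p.1).1 • q = j := by
  classical
  let N := Nat.find (S.exists_rep l hl (S.incl n p))
  let r : S.Level (l N) := (Nat.find_spec (S.exists_rep l hl (S.incl n p))).choose
  have hr : S.incl (l N) r = S.incl n p :=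
    (Nat.find_spec (S.exists_rep l hl (S.incl n p))).choose_spec
  refine (S.telescope l hl).isFactorValue_incl_iff.trans (eventually_congr ?_)
  filter_upwards [eventually_ge_atTop N,
    hl.strictMono.tendsto_atTop.eventually (S.eventually_advance_eq hr)] with k hk hadv
  rw [S.advance_telescopeLevel_fst, Nat.add_sub_cancel' hk, hadv]

lemma factorMap_eq {x : S.Space} (h : S.IsFactorValue q x j) : S.factorMap q x = j := by
  have hex : ∃ i, S.IsFactorValue q x i := ⟨j, h⟩
  have hchoose := hex.choose_spec
  rw [factorMap, dif_pos hex]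
  obtain ⟨n, p, rfl⟩ := S.exists_incl x
  obtain ⟨k, hk, hk'⟩ :=
    ((S.isFactorValue_incl_iff.1 h).and (S.isFactorValue_incl_iff.1 hchoose)).exists
  exact hk'.symm.trans hk

end FactorValue

variable [Countable G] [TopologicalSpace G] [DiscreteTopology G] [MeasurableSpace G] [BorelSpace G]

lemma measurableSet_of_preimage_incl {A : Set S.Space}
    (h : ∀ n, MeasurableSet (S.incl n ⁻¹' A)) : MeasurableSet A := by
  have hA : A = ⋃ n, S.incl n '' (S.incl n ⁻¹' A) := by
    ext x
    obtain ⟨n, p, rfl⟩ := S.exists_incl x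
    simp only [mem_iUnion]
    exact ⟨fun hx => ⟨n, p, hx, rfl⟩, fun ⟨_, _, hr, e⟩ => e ▸ hr⟩
  rw [hA]
  exact .iUnion fun n => (S.measurableEmbedding_incl n).measurableSet_image.2 (h n)

lemma measurableSet_isFactorValue_iota {Γ : Subgroup G} (q j : G ⧸ Γ) {l : ℕ → ℕ}
    (hl : IsTelescopingSeq l) :
    MeasurableSet {x | (S.telescope l hl).IsFactorValue q (S.iota l hl x) j} := by
  refine S.measurableSet_of_preimage_incl fun n => ?_
  have hmeas (k : ℕ) : MeasurableSet {p : S.Level n | (advance (l k - n) p.1).1 • q = j} :=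
    (measurable_fst.comp ((measurable_advance _).comp measurable_subtype_coe))
      (.of_discrete (s := {a : G | a • q = j}))
  convert MeasurableSet.measurableSet_liminf hmeas using 1
  ext p
  rw [mem_liminf_iff_eventually_mem]
  exact S.isFactorValue_iota_incl_iff hl

lemma measurable_factorMap_iota {Γ : Subgroup G} (q : G ⧸ Γ) {l : ℕ → ℕ}
    (hl : IsTelescopingSeq l) :
    Measurable fun x => (S.telescope l hl).factorMap q (S.iota l hl x) := by
  have := (QuotientGroup.mk_surjective (s := Γ)).countable
  exact measurable_of_measurableSet_graph (S.measurableSet_isFactorValue_iota q · hl)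
    (fun _ _ => (S.telescope l hl).factorMap_eq) fun _ hx => dif_neg (not_exists.2 hx)

end CFSeq

namespace CFData.Admissible

section Discrete

variable {G : Type u} [Group G] [Countable G] [MeasurableSpace G] [DiscreteMeasurableSpace G]
  {D : CFData G} (hD : D.Admissible)
include hD

lemma measurePreserving_shift (n k : ℕ) :
    MeasurePreserving (fun (c : ℕ → G) i => c (k + i)) (D.seqMeasure n) (D.seqMeasure (n + k)) :=
  have := hD.isProbabilityMeasure_seqMeasure
  have := hD.isProbabilityMeasure_κprod n k
  measurePreserving_snd.comp (hD.measurePreserving_listProd_shift n k)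

lemma measurePreserving_listProd (n k : ℕ) :
    MeasurePreserving (fun c : ℕ → G => listProd c 0 k) (D.seqMeasure n) (D.κprod n (n + k)) :=
  have := hD.isProbabilityMeasure_seqMeasure
  measurePreserving_fst.comp (hD.measurePreserving_listProd_shift n k)

lemma seqMeasure_listProd_mem {n m : ℕ} (h : n ≤ m) (A : Set G) :
    D.seqMeasure n {c | listProd c 0 (m - n) ∈ A} = D.κprod n m A := by
  obtain ⟨k, rfl⟩ := Nat.exists_eq_add_of_le h
  rw [Nat.add_sub_cancel_left]
  exact (hD.measurePreserving_listProd n k).measure_preimage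
    MeasurableSet.of_discrete.nullMeasurableSet

lemma κprod_sep_Cprod {n m : ℕ} (h : n ≤ m) (P : G → Prop) :
    D.κprod n m {c ∈ D.Cprod n m | P c} = D.κprod n m {c | P c} := by
  rw [← hD.seqMeasure_listProd_mem h, ← hD.seqMeasure_listProd_mem h]
  refine measure_congr ?_
  filter_upwards [hD.ae_mem_C n] with c hc
  have hmem := D.listProd_mem_Cprod n c hc (Nat.zero_le (m - n))
  rw [add_zero, Nat.add_sub_cancel' h] at hmem
  exact propext (and_iff_right hmem)

lemma compatibleWith_telescope_iff {Γ : Subgroup G} {g : G} {l : ℕ → ℕ}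
    {hl : IsTelescopingSeq l} :
    (D.telescope l hl).CompatibleWith Γ g ↔
      ∑' k, D.κprod (l k) (l (k + 1)) {c | c • (g : G ⧸ Γ) ≠ g} ≠ ∞ := by
  have hterm (k : ℕ) : (D.telescope l hl).κ k
      {c ∈ (D.telescope l hl).C k | c ∉ Γ.map (MulAut.conj g).toMonoidHom} =
        D.κprod (l k) (l (k + 1)) {c | c • (g : G ⧸ Γ) ≠ g} := by
    simp only [mem_map_conj_iff]
    exact hD.κprod_sep_Cprod (hl.strictMono k.lt_succ_self).le _
  rw [CompatibleWith, lt_top_iff_ne_top, tsum_congr hterm]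

lemma ae_eventually_shift_notMem {l : ℕ → ℕ} (hl : Tendsto l atTop atTop)
    {E : ℕ → Set (ℕ → G)} (hE : ∀ k, MeasurableSet (E k))
    (hsum : ∑' k, D.seqMeasure (l k) (E k) ≠ ∞) (n : ℕ) :
    ∀ᵐ c ∂D.seqMeasure n, ∀ᶠ k in atTop, (fun i => c (l k - n + i)) ∉ E k := by
  have hle (k : ℕ) : D.seqMeasure n {c | n ≤ l k ∧ (fun i => c (l k - n + i)) ∈ E k} ≤
      D.seqMeasure (l k) (E k) := by
    by_cases hk : n ≤ l k
    · have h := hD.measurePreserving_shift n (l k - n)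
      rw [Nat.add_sub_cancel' hk] at h
      simp only [hk, true_and]
      exact (h.measure_preimage (hE k).nullMeasurableSet).le
    · simp only [hk, false_and, ofPred_false, measure_empty, zero_le]
  filter_upwards [ae_eventually_notMem (ne_top_of_le_ne_top hsum (ENNReal.tsum_le_tsum hle))]
    with c hc
  filter_upwards [hc, hl.eventually_ge_atTop n] with k hk hnk using fun h => hk ⟨hnk, h⟩

end Discrete

variable {G : Type u} [Group G] [Countable G] [TopologicalSpace G] [DiscreteTopology G]
  [MeasurableSpace G] [BorelSpace G] {D : CFData G} (hD : D.Admissible) {Γ : Subgroup G} {g : G}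
  {l : ℕ → ℕ} {hl : IsTelescopingSeq l}
include hD

lemma ae_exists_isFactorValue (hc : (D.telescope l hl).CompatibleWith Γ g) :
    ∀ᵐ x ∂D.μ, ∃ j, (D.telescope l hl).IsFactorValue (g : G ⧸ Γ) (D.iota l hl x) j := by
  have := hD.fin_ν
  have := hD.isProbabilityMeasure_seqMeasure
  have hle (k : ℕ) : l k ≤ l (k + 1) := (hl.strictMono k.lt_succ_self).le
  let E (k : ℕ) : Set (ℕ → G) := {c | listProd c 0 (l (k + 1) - l k) • (g : G ⧸ Γ) ≠ g}
  have hE (k : ℕ) : MeasurableSet (E k) :=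
    measurable_listProd 0 _ (.of_discrete (s := {a : G | a • (g : G ⧸ Γ) ≠ g}))
  have hsum : ∑' k, D.seqMeasure (l k) (E k) ≠ ∞ := by
    convert hD.compatibleWith_telescope_iff.1 hc using 3 with k
    exact hD.seqMeasure_listProd_mem (hle k) {a | a • (g : G ⧸ Γ) ≠ g}
  refine hD.ae_μ_iff.2 fun n => ?_
  filter_upwards [hD.ae_mem_levelSet n, Measure.quasiMeasurePreserving_snd.ae
    (hD.ae_eventually_shift_notMem hl.strictMono.tendsto_atTop hE hsum n)] with p hp hshift
  have hconst : EventuallyConst (fun k => (advance (l k - n) p).1 • (g : G ⧸ Γ)) atTop := by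
    obtain ⟨K, hK⟩ := eventually_atTop.1
      (hshift.and (hl.strictMono.tendsto_atTop.eventually_ge_atTop n))
    refine eventuallyConst_atTop_nat.2 ⟨K, fun k hk => ?_⟩
    obtain ⟨hfix, hn⟩ := hK k hk
    have hsplit : l (k + 1) - n = l k - n + (l (k + 1) - l k) := by have := hle k; omega
    rw [hsplit, advance_add, advance, mul_smul]
    exact congrArg _ (not_ne_iff.1 hfix)
  obtain ⟨j, hj⟩ := eventuallyConst_iff_exists_eventuallyEq.1 hconst
  rw [D.point_of_mem hp]
  exact ⟨j, (D.isFactorValue_iota_incl_iff hl).2 hj⟩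

lemma isFactorMap_factorMap_iota (hc : (D.telescope l hl).CompatibleWith Γ g) :
    D.IsFactorMap fun x => (D.telescope l hl).factorMap (g : G ⧸ Γ) (D.iota l hl x) := by
  refine ⟨D.measurable_factorMap_iota _ hl, fun a => ?_⟩
  filter_upwards [hD.ae_exists_isFactorValue hc, hD.ae_mem_fullDomain] with x ⟨j, hj⟩ hx
  obtain ⟨n, p, rfl, hp⟩ := mem_iInter.1 hx a
  rw [D.act_incl a p hx hp, (D.telescope l hl).factorMap_eq hj]
  refine (D.telescope l hl).factorMap_eq ((D.isFactorValue_iota_incl_iff hl).2 ?_)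
  filter_upwards [(D.isFactorValue_iota_incl_iff hl).1 hj] with k hk
  rw [advance_mul_left, mul_smul, hk]

end CFData.Admissible

/-! ### Coherent sequences and factor maps -/

lemma exists_telescopingSeq_tsum_ne_top {p : ℕ → Prop} (hp : ∃ᶠ n in atTop, p n)
    {u : ℕ → ℝ≥0∞} (hu : Tendsto u atTop (𝓝 0)) :
    ∃ l, IsTelescopingSeq l ∧ (∀ k, p (l (k + 1))) ∧ ∑' k, u (l (k + 1)) ≠ ∞ := by
  obtain ⟨ε, hε, hsum⟩ := ENNReal.exists_pos_sum_of_countable one_ne_zero ℕ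
  have hfreq (k : ℕ) : ∃ᶠ n in atTop, p n ∧ u n ≤ ε k ∧ 0 < n :=
    hp.and_eventually ((ENNReal.tendsto_nhds_zero.1 hu (ε k) (by exact_mod_cast hε k)).and
      (eventually_gt_atTop 0))
  obtain ⟨φ, hφ, hpφ⟩ := extraction_forall_of_frequently hfreq
  refine ⟨fun k => Nat.casesOn k 0 φ, ⟨rfl, strictMono_nat_of_lt_succ ?_⟩, fun k => (hpφ k).1, ?_⟩
  · rintro (_ | k)
    · exact (hpφ 0).2.2
    · exact hφ k.lt_succ_self
  · exact ne_top_of_le_ne_top (hsum.trans ENNReal.one_lt_top).ne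
      (ENNReal.tsum_le_tsum fun k => (hpφ k).2.1)

namespace CFData

section Coherent

variable {G : Type u} [Group G] [MeasurableSpace G]

/-- `sup_{m > n ≥ N} κ_{n+1,m} {c | c q_m ≠ q_n}` for a sequence `q` in a `G`-space. -/
noncomputable def coherenceDefect (D : CFData G) {Y : Type*} [MulAction G Y] (q : ℕ → Y) (N : ℕ) :
    ℝ≥0∞ :=
  ⨆ (n : ℕ) (m : ℕ) (_ : N ≤ n) (_ : n < m), D.κprod n m {c | c • q m ≠ q n}

/-- A sequence `q` in a `G`-space is coherent if a `κ_{n+1,m}`-random element carries `q_m` to `q_n`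
with probability tending to `1`, uniformly in `m > n`. -/
def IsCoherent (D : CFData G) {Y : Type*} [MulAction G Y] (q : ℕ → Y) : Prop :=
  Tendsto (D.coherenceDefect q) atTop (𝓝 0)

variable (D : CFData G)

lemma κprod_le_coherenceDefect {Y : Type*} [MulAction G Y] (q : ℕ → Y) {n m : ℕ} (h : n < m) :
    D.κprod n m {c | c • q m ≠ q n} ≤ D.coherenceDefect q n :=
  le_iSup₂_of_le n m (le_iSup₂_of_le le_rfl h le_rfl)

lemma isCoherent_of_le_add {Y : Type*} [MulAction G Y] {q : ℕ → Y} {δ : ℕ → ℝ≥0∞}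
    (hδ : Tendsto δ atTop (𝓝 0))
    (h : ∀ n m, n < m → D.κprod n m {c | c • q m ≠ q n} ≤ δ n + δ m) : D.IsCoherent q := by
  refine ENNReal.tendsto_nhds_zero.2 fun ε hε => ?_
  filter_upwards [eventually_forall_ge_atTop.2
    (ENNReal.tendsto_nhds_zero.1 hδ (ε / 2) (ENNReal.half_pos hε.ne'))] with N hN
  refine iSup₂_le fun n m => iSup₂_le fun hn hnm => ?_
  calc D.κprod n m {c | c • q m ≠ q n} ≤ δ n + δ m := h n m hnm
    _ ≤ ε / 2 + ε / 2 := add_le_add (hN n hn) (hN m (hn.trans hnm.le))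
    _ = ε := ENNReal.add_halves ε

namespace Admissible

variable [Countable G] [DiscreteMeasurableSpace G] {D} (hD : D.Admissible) {Γ : Subgroup G}
include hD

lemma exists_isCoherent_iff :
    (∃ q : ℕ → G ⧸ Γ, D.IsCoherent q) ↔
      ∃ g : ℕ → G, Tendsto (fun N : ℕ => ⨆ (n : ℕ) (m : ℕ) (_ : N ≤ n) (_ : n < m),
        D.κprod n m {c ∈ D.Cprod n m | c ∉ ({(g n)⁻¹} * (Γ : Set G) * {g m} : Set G)})
        atTop (𝓝 0) := by
  have hdefect (g : ℕ → G) : (fun N : ℕ => ⨆ (n : ℕ) (m : ℕ) (_ : N ≤ n) (_ : n < m),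
      D.κprod n m {c ∈ D.Cprod n m | c ∉ ({(g n)⁻¹} * (Γ : Set G) * {g m} : Set G)}) =
        D.coherenceDefect fun n => (((g n)⁻¹ : G) : G ⧸ Γ) := by
    refine funext fun N => iSup_congr fun n => iSup_congr fun m =>
      iSup_congr fun _ => iSup_congr fun hnm => ?_
    rw [hD.κprod_sep_Cprod hnm.le]
    simp only [mem_inv_mul_mul_iff, ne_eq]
  have hsurj : Function.Surjective fun (g : ℕ → G) n => (((g n)⁻¹ : G) : G ⧸ Γ) :=
    (QuotientGroup.mk_surjective.comp inv_surjective).comp_left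
  simp only [hdefect, hsurj.exists, IsCoherent]

lemma compatibleWith_telescope_of_tsum_ne_top {g : G} {l : ℕ → ℕ} (hl : IsTelescopingSeq l)
    (hsum : ∑' k, D.κprod (l (k + 1)) (l (k + 2)) {c | c • (g : G ⧸ Γ) ≠ g} ≠ ∞) :
    (D.telescope l hl).CompatibleWith Γ g := by
  have hprob : IsProbabilityMeasure (D.κprod (l 0) (l (0 + 1))) := by
    rw [hl.zero, ← zero_add (l _)]
    exact hD.isProbabilityMeasure_κprod _ _
  rw [hD.compatibleWith_telescope_iff, tsum_eq_zero_add' ENNReal.summable]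
  exact ENNReal.add_ne_top.2 ⟨measure_ne_top _ _, hsum⟩

lemma exists_compatibleWith_of_isCoherent [Γ.FiniteIndex] {q : ℕ → G ⧸ Γ}
    (hq : D.IsCoherent q) :
    ∃ (g : G) (l : ℕ → ℕ) (hl : IsTelescopingSeq l), (D.telescope l hl).CompatibleWith Γ g := by
  obtain ⟨j, hj⟩ : ∃ j, ∃ᶠ n in atTop, q n = j := frequently_exists.1 (.of_forall fun n => ⟨_, rfl⟩)
  obtain ⟨g, rfl⟩ := QuotientGroup.mk_surjective j
  obtain ⟨l, hl, hql, hsum⟩ := exists_telescopingSeq_tsum_ne_top hj hq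
  refine ⟨g, l, hl, hD.compatibleWith_telescope_of_tsum_ne_top hl (ne_top_of_le_ne_top hsum
    (ENNReal.tsum_le_tsum fun k => ?_))⟩
  simpa only [hql] using D.κprod_le_coherenceDefect q (hl.strictMono (k + 1).lt_succ_self)

end Admissible

end Coherent

lemma exists_measure_ne_le {α Y : Type*} [MeasurableSpace α] [MeasurableSpace Y] [Countable Y]
    [MeasurableSingletonClass Y] (P : Measure α) [IsProbabilityMeasure P] {θ : α → Y}
    (hθ : Measurable θ) : ∃ y, P {a | θ a ≠ y} ≤ (P.prod P) {p | θ p.2 ≠ θ p.1} := by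
  have hne : MeasurableSet {p : α × α | θ p.2 ≠ θ p.1} :=
    (measurableSet_eq_fun (hθ.comp measurable_snd) (hθ.comp measurable_fst)).compl
  obtain ⟨a, ha⟩ := exists_le_lintegral (measurable_measure_prodMk_left (ν := P) hne).aemeasurable
    (μ := P)
  rw [← Measure.prod_apply hne] at ha
  exact ⟨θ a, ha⟩

section BaseMap

variable {G : Type u} [Group G] [MeasurableSpace G] {D : CFData G} {Y : Type*}

/-- The restriction of a map `τ` on `X` to the subset `{1} × C_{n+1} × C_{n+2} × ⋯` of `X_n`
(extended to all sequences by the junk values of `CFSeq.point`). -/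
noncomputable def baseMap (D : CFData G) (τ : D.Space → Y) (n : ℕ) (c : ℕ → G) : Y :=
  τ (D.point n (1, c))

variable [Countable G] [TopologicalSpace G] [DiscreteTopology G] [BorelSpace G]
  [MeasurableSpace Y] {τ : D.Space → Y}

lemma measurable_baseMap (hτ : Measurable τ) (n : ℕ) : Measurable (D.baseMap τ n) :=
  hτ.comp ((D.measurable_point n).comp measurable_prodMk_left)

namespace Admissible

variable (hD : D.Admissible) [MulAction G Y] (hτ : D.IsFactorMap τ)
include hD hτ

lemma ae_eq_smul_baseMap (n : ℕ) :
    ∀ᵐ c ∂D.seqMeasure n, ∀ f ∈ D.F n, τ (D.point n (f, c)) = f • D.baseMap τ n c := by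
  have hequi := hD.ae_seqMeasure_of_ae
    (hD.ae_μ_iff.1 (hD.ae_mem_fullDomain.and (ae_all_iff.2 hτ.2)) n) (D.one_mem_F n)
  filter_upwards [hequi, hD.ae_mem_C n] with c ⟨hfull, hact⟩ hc f hf
  have h₁ : ((1 : G), c) ∈ D.levelSet n := ⟨D.one_mem_F n, hc⟩
  have hfc : (f, c) ∈ D.levelSet n := ⟨hf, hc⟩
  have hval : D.act f (D.point n (1, c)) = D.point n (f, c) := by
    rw [D.point_of_mem h₁] at hfull ⊢
    rw [D.act_incl f _ hfull (by simpa only [mul_one] using hf), D.point_of_mem hfc]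
    simp only [mul_one]
  rw [← hval, hact f, baseMap]

lemma ae_baseMap_eq (n k : ℕ) :
    ∀ᵐ c ∂D.seqMeasure n,
      D.baseMap τ n c = listProd c 0 k • D.baseMap τ (n + k) (fun i => c (k + i)) := by
  filter_upwards [hD.ae_mem_C n, (hD.measurePreserving_shift n k).quasiMeasurePreserving.ae
    (hD.ae_eq_smul_baseMap hτ (n + k))] with c hc hsmul
  have h₁ : ((1 : G), c) ∈ D.levelSet n := ⟨D.one_mem_F n, hc⟩
  rw [baseMap, ← D.point_advance h₁ k, advance, one_mul]
  exact hsmul _ (one_mul (listProd c 0 k) ▸ (D.advance_mem_levelSet h₁ k).1)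

lemma ae_smul_baseMap_eq (n k : ℕ) :
    ∀ᵐ p ∂D.prodMeasure n, τ (D.point n p) =
      (advance k p).1 • D.baseMap τ (n + k) (advance k p).2 := by
  have := hD.fin_ν
  have := hD.isProbabilityMeasure_seqMeasure
  filter_upwards [hD.ae_mem_levelSet n,
    Measure.quasiMeasurePreserving_snd.ae (hD.ae_eq_smul_baseMap hτ n),
    Measure.quasiMeasurePreserving_snd.ae (hD.ae_baseMap_eq hτ n k)] with p hp hsmul hbase
  rw [hsmul p.1 hp.1, hbase, smul_smul]
  rfl

variable [MeasurableSingletonClass Y]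

lemma κprod_smul_ne_le {n m : ℕ} (h : n ≤ m) (i j : Y) :
    D.κprod n m {c | c • j ≠ i} ≤ D.seqMeasure n {c | D.baseMap τ n c ≠ i} +
      D.seqMeasure m {c | D.baseMap τ m c ≠ j} := by
  obtain ⟨k, rfl⟩ := Nat.exists_eq_add_of_le h
  have hne : MeasurableSet {c | D.baseMap τ (n + k) c ≠ j} :=
    (measurable_baseMap hτ.1 (n + k) (measurableSet_singleton j)).compl
  rw [← (hD.measurePreserving_listProd n k).measure_preimage
      MeasurableSet.of_discrete.nullMeasurableSet,
    ← (hD.measurePreserving_shift n k).measure_preimage hne.nullMeasurableSet]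
  refine (measure_mono_ae ?_).trans (measure_union_le _ _)
  filter_upwards [hD.ae_baseMap_eq hτ n k] with c hbase hc
  by_contra hcon
  obtain ⟨hi, hj⟩ := not_or.1 hcon
  exact hc (by rw [← not_ne_iff.1 hi, hbase, ← not_ne_iff.1 hj])

variable [Countable Y]

lemma tendsto_prod_baseMap_ne :
    Tendsto (fun m => ((D.seqMeasure m).prod (D.seqMeasure m))
      {p | D.baseMap τ m p.2 ≠ D.baseMap τ m p.1}) atTop (𝓝 0) := by
  have := hD.prob_κ
  have := hD.isProbabilityMeasure_seqMeasure
  have hsplice : Tendsto (fun m => ((D.seqMeasure 0).prod (D.seqMeasure m))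
      {p | D.baseMap τ 0 (splice m p.1 p.2) ≠ D.baseMap τ 0 p.1}) atTop (𝓝 0) := by
    simpa only [seqMeasure, zero_add] using
      tendsto_measure_splice_ne D.κ (measurable_baseMap hτ.1 0)
  refine hsplice.congr fun m => ?_
  have hbase : ∀ᵐ c ∂D.seqMeasure 0, D.baseMap τ 0 c =
      listProd c 0 m • D.baseMap τ m (fun i => c (m + i)) := by
    simpa only [zero_add] using hD.ae_baseMap_eq hτ 0 m
  have hsp : MeasurePreserving (fun p : (ℕ → G) × (ℕ → G) => splice m p.1 p.2)
      ((D.seqMeasure 0).prod (D.seqMeasure m)) (D.seqMeasure 0) := by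
    simpa only [seqMeasure, zero_add] using measurePreserving_splice D.κ m
  have hshift := hD.measurePreserving_shift 0 m
  rw [zero_add] at hshift
  have hne : MeasurableSet {p : (ℕ → G) × (ℕ → G) | D.baseMap τ m p.2 ≠ D.baseMap τ m p.1} :=
    (measurableSet_eq_fun ((measurable_baseMap hτ.1 m).comp measurable_snd)
      ((measurable_baseMap hτ.1 m).comp measurable_fst)).compl
  rw [← (hshift.prod (.id (D.seqMeasure m))).measure_preimage hne.nullMeasurableSet]
  refine measure_congr ?_
  filter_upwards [hsp.quasiMeasurePreserving.ae hbase,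
    Measure.quasiMeasurePreserving_fst.ae hbase] with p hsp hp
  refine propext (not_congr ?_)
  rw [hsp, hp, listProd_splice, smul_left_cancel_iff]
  simp only [splice_add]
  rfl

lemma exists_tendsto_baseMap_ne :
    ∃ q : ℕ → Y, Tendsto (fun n => D.seqMeasure n {c | D.baseMap τ n c ≠ q n}) atTop (𝓝 0) := by
  have := hD.isProbabilityMeasure_seqMeasure
  choose q hq using fun n => exists_measure_ne_le (D.seqMeasure n) (measurable_baseMap hτ.1 n)
  exact ⟨q, tendsto_of_tendsto_of_tendsto_of_le_of_le tendsto_const_nhds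
    (hD.tendsto_prod_baseMap_ne hτ) (fun _ => zero_le) hq⟩

lemma exists_isCoherent : ∃ q : ℕ → Y, D.IsCoherent q := by
  obtain ⟨q, hq⟩ := hD.exists_tendsto_baseMap_ne hτ
  exact ⟨q, isCoherent_of_le_add D hq fun n m h => hD.κprod_smul_ne_le hτ h.le (q n) (q m)⟩

end Admissible

end BaseMap

namespace Admissible

variable {G : Type u} [Group G] [Countable G] [TopologicalSpace G] [DiscreteTopology G]
  [MeasurableSpace G] [BorelSpace G] {D : CFData G} (hD : D.Admissible) {Γ : Subgroup G}
include hD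

lemma ae_eq_factorMap_iota {τ : D.Space → G ⧸ Γ} (hτ : D.IsFactorMap τ) {g : G} {l : ℕ → ℕ}
    (hl : IsTelescopingSeq l)
    (hsum : ∑' k, D.seqMeasure (l (k + 1)) {c | D.baseMap τ (l (k + 1)) c ≠ g} ≠ ∞) :
    τ =ᵐ[D.μ] fun x => (D.telescope l hl).factorMap (g : G ⧸ Γ) (D.iota l hl x) := by
  have := hD.fin_ν
  have := hD.isProbabilityMeasure_seqMeasure
  have hne (k : ℕ) : MeasurableSet {c | D.baseMap τ (l k) c ≠ g} :=
    (measurable_baseMap hτ.1 (l k) (measurableSet_singleton _)).compl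
  replace hsum : ∑' k, D.seqMeasure (l k) {c | D.baseMap τ (l k) c ≠ g} ≠ ∞ := by
    rw [tsum_eq_zero_add' ENNReal.summable]
    exact ENNReal.add_ne_top.2 ⟨measure_ne_top _ _, hsum⟩
  refine hD.ae_μ_iff.2 fun n => ?_
  filter_upwards [hD.ae_mem_levelSet n, ae_all_iff.2 (hD.ae_smul_baseMap_eq hτ n),
    Measure.quasiMeasurePreserving_snd.ae
      (hD.ae_eventually_shift_notMem hl.strictMono.tendsto_atTop hne hsum n)]
    with p hp hsmul hshift
  refine ((D.telescope l hl).factorMap_eq ?_).symm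
  rw [D.point_of_mem hp]
  refine (D.isFactorValue_iota_incl_iff hl).2 ?_
  filter_upwards [hshift, hl.strictMono.tendsto_atTop.eventually_ge_atTop n] with k hk hn
  have hval := hsmul (l k - n)
  rw [Nat.add_sub_cancel' hn] at hval
  rw [← D.point_of_mem hp, hval]
  exact congrArg _ (not_ne_iff.1 hk).symm

variable [Γ.FiniteIndex]

lemma exists_compatibleWith_ae_eq {τ : D.Space → G ⧸ Γ} (hτ : D.IsFactorMap τ) :
    ∃ (g : G) (l : ℕ → ℕ) (hl : IsTelescopingSeq l), (D.telescope l hl).CompatibleWith Γ g ∧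
      τ =ᵐ[D.μ] fun x => (D.telescope l hl).factorMap (g : G ⧸ Γ) (D.iota l hl x) := by
  have : Countable (G ⧸ Γ) := (QuotientGroup.mk_surjective (s := Γ)).countable
  obtain ⟨q, hq⟩ := hD.exists_tendsto_baseMap_ne hτ
  obtain ⟨j, hj⟩ : ∃ j, ∃ᶠ n in atTop, q n = j := frequently_exists.1 (.of_forall fun n => ⟨_, rfl⟩)
  obtain ⟨g, rfl⟩ := QuotientGroup.mk_surjective j
  obtain ⟨l, hl, hql, hsum⟩ := exists_telescopingSeq_tsum_ne_top hj hq
  simp only [hql] at hsum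
  refine ⟨g, l, hl, hD.compatibleWith_telescope_of_tsum_ne_top hl ?_,
    hD.ae_eq_factorMap_iota hτ hl hsum⟩
  have hsum' := ne_top_of_le_ne_top hsum
    (ENNReal.tsum_comp_le_tsum_of_injective (add_left_injective 1) _)
  refine ne_top_of_le_ne_top (ENNReal.add_ne_top.2 ⟨hsum, hsum'⟩) ?_
  rw [← ENNReal.tsum_add]
  exact ENNReal.tsum_le_tsum fun k =>
    hD.κprod_smul_ne_le hτ (hl.strictMono (k + 1).lt_succ_self).le _ _

end Admissible

end CFData

namespace CFData

variable {G : Type u} [Group G] [MeasurableSpace G]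

lemma compatibleWith_map_conj_one_iff (D : CFData G) {Γ : Subgroup G} {g : G} :
    D.CompatibleWith (Γ.map (MulAut.conj g).toMonoidHom) 1 ↔ D.CompatibleWith Γ g := by
  have hconj (Δ : Subgroup G) : Δ.map (MulAut.conj (1 : G)).toMonoidHom = Δ := by
    rw [map_one]
    exact Δ.map_id
  rw [CompatibleWith, hconj, CompatibleWith]

lemma hasFactorIsomorphicTo_iff [TopologicalSpace G] (D : CFData G) {Γ : Subgroup G} :
    D.HasFactorIsomorphicTo Γ ↔ ∃ τ : D.Space → G ⧸ Γ, D.IsFactorMap τ := by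
  constructor
  · rintro ⟨Y, _, _, φ, e, ⟨hφ, hequi⟩, he⟩
    refine ⟨e ∘ φ, e.measurable.comp hφ, fun g => ?_⟩
    filter_upwards [hequi g] with x hx
    rw [Function.comp_apply, hx, he, Function.comp_apply]
  · rintro ⟨τ, hτ⟩
    exact ⟨G ⧸ Γ, inferInstance, inferInstance, τ, .refl _, hτ, fun _ _ => rfl⟩

end CFData

theorem theorem2p3_general {G : Type u} [Group G] [Countable G]
    [TopologicalSpace G] [DiscreteTopology G] [MeasurableSpace G] [BorelSpace G]
    (D : CFData G) (hD : D.Admissible)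
    (Γ : Subgroup G) [Γ.FiniteIndex] :
    List.TFAE [
      ∃ τ : D.Space → G ⧸ Γ, D.IsFactorMap τ,
      ∃ g : ℕ → G, Tendsto (fun N : ℕ => ⨆ (n : ℕ) (m : ℕ) (_ : N ≤ n) (_ : n < m),
        D.κprod n m {c ∈ D.Cprod n m | c ∉ ({(g n)⁻¹} * (Γ : Set G) * {g m} : Set G)})
        atTop (𝓝 0),
      ∃ (g₀ : G) (l : ℕ → ℕ) (hl : IsTelescopingSeq l),
        (D.telescope l hl).CompatibleWith Γ g₀] ∧
    (∀ (g₀ : G) (l : ℕ → ℕ) (hl : IsTelescopingSeq l),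
      (D.telescope l hl).CompatibleWith Γ g₀ →
        (∀ᵐ x ∂D.μ, ∃ j, (D.telescope l hl).IsFactorValue (g₀ : G ⧸ Γ) (D.iota l hl x) j) ∧
        D.IsFactorMap fun x => (D.telescope l hl).factorMap (g₀ : G ⧸ Γ) (D.iota l hl x)) ∧
    (∀ τ : D.Space → G ⧸ Γ, D.IsFactorMap τ →
      ∃ (g₀ : G) (l : ℕ → ℕ) (hl : IsTelescopingSeq l),
        (D.telescope l hl).CompatibleWith Γ g₀ ∧
        τ =ᵐ[D.μ] fun x => (D.telescope l hl).factorMap (g₀ : G ⧸ Γ) (D.iota l hl x)) ∧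
    (¬ D.HasFactorIsomorphicTo Γ ↔
      ¬ ∃ (g : G) (l : ℕ → ℕ) (hl : IsTelescopingSeq l),
        (D.telescope l hl).CompatibleWith (Γ.map (MulAut.conj g).toMonoidHom) 1) := by
  refine ⟨?tfae,
    fun _ _ _ hc => ⟨hD.ae_exists_isFactorValue hc, hD.isFactorMap_factorMap_iota hc⟩,
    fun _ hτ => hD.exists_compatibleWith_ae_eq hτ, ?isomorphic⟩
  case tfae =>
    have : Countable (G ⧸ Γ) := (QuotientGroup.mk_surjective (s := Γ)).countable
    rw [← hD.exists_isCoherent_iff]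
    tfae_have 1 → 2 := fun ⟨τ, hτ⟩ => hD.exists_isCoherent hτ
    tfae_have 2 → 3 := fun ⟨q, hq⟩ => hD.exists_compatibleWith_of_isCoherent hq
    tfae_have 3 → 1 := fun ⟨g, l, hl, hc⟩ => ⟨_, hD.isFactorMap_factorMap_iota hc⟩
    tfae_finish
  case isomorphic =>
    simp only [CFData.compatibleWith_map_conj_one_iff, D.hasFactorIsomorphicTo_iff]
    refine not_congr ⟨fun ⟨τ, hτ⟩ => ?_, fun ⟨g, l, hl, hc⟩ =>
      ⟨_, hD.isFactorMap_factorMap_iota hc⟩⟩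
    obtain ⟨g, l, hl, hc, -⟩ := hD.exists_compatibleWith_ae_eq hτ
    exact ⟨g, l, hl, hc⟩

theorem theorem2p3 {G : Type u} [Group G] [Countable G] [Infinite G]
    [TopologicalSpace G] [DiscreteTopology G] [MeasurableSpace G] [BorelSpace G]
    (D : CFData G) (hD : D.Admissible)
    (hfin : ∃ L < ∞, Tendsto (fun n => D.ν n (D.F n)) atTop (𝓝 L))
    (Γ : Subgroup G) [Γ.FiniteIndex] :
    List.TFAE [
      ∃ τ : D.Space → G ⧸ Γ, D.IsFactorMap τ,
      ∃ g : ℕ → G, Tendsto (fun N : ℕ => ⨆ (n : ℕ) (m : ℕ) (_ : N ≤ n) (_ : n < m),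
        D.κprod n m {c ∈ D.Cprod n m | c ∉ ({(g n)⁻¹} * (Γ : Set G) * {g m} : Set G)})
        atTop (𝓝 0),
      ∃ (g₀ : G) (l : ℕ → ℕ) (hl : IsTelescopingSeq l),
        (D.telescope l hl).CompatibleWith Γ g₀] ∧
    (∀ (g₀ : G) (l : ℕ → ℕ) (hl : IsTelescopingSeq l),
      (D.telescope l hl).CompatibleWith Γ g₀ →
        (∀ᵐ x ∂D.μ, ∃ j, (D.telescope l hl).IsFactorValue (g₀ : G ⧸ Γ) (D.iota l hl x) j) ∧
        D.IsFactorMap fun x => (D.telescope l hl).factorMap (g₀ : G ⧸ Γ) (D.iota l hl x)) ∧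
    (∀ τ : D.Space → G ⧸ Γ, D.IsFactorMap τ →
      ∃ (g₀ : G) (l : ℕ → ℕ) (hl : IsTelescopingSeq l),
        (D.telescope l hl).CompatibleWith Γ g₀ ∧
        τ =ᵐ[D.μ] fun x => (D.telescope l hl).factorMap (g₀ : G ⧸ Γ) (D.iota l hl x)) ∧
    (¬ D.HasFactorIsomorphicTo Γ ↔
      ¬ ∃ (g : G) (l : ℕ → ℕ) (hl : IsTelescopingSeq l),
        (D.telescope l hl).CompatibleWith (Γ.map (MulAut.conj g).toMonoidHom) 1) :=
  theorem2p3_general D hD Γ
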